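/- Let $d_w\ge 1$ be fixed. For each sample size $n$ let $(y_i,d_i,w_i,\varepsilon_i)_{i\le n}$ be random variables on a probability space, with $y_i,d_i,\varepsilon_i$ real-valued and $w_i$ with values in $\mathbb R^{d_w}$, such that $$y_i=d_i\beta+w_i^\top\gamma+\varepsilon_i,\qquad \mathbb E[\varepsilon_i]=0,\qquad i=1,\dots,n .$$ The variables, their joint distribution, and $\beta\in\mathbb R$, $\gamma\in\mathbb R^{d_w}$ may all depend on $n$ (triangular array); this dependence is suppressed. Let $K,\delta_1,\delta_2>0$ be constants independent of $n$; limits are as $n\to\infty$, and $o_p(1)$ denotes a sequence that converges to zero in probability. Assume: 1. (i) for each $n$, $d_1,\dots,d_n$ are i.i.d. with mean $\mu_d$ and variance $\sigma_d^2$; (ii) $(d_i)_{i\le n}$ is independent of $(w_i)_{i\le n}$; (iii) $\max_{i\le n}\mathbb E[|d_i|^{2+\delta_1}]\le K$; (iv) $\sigma_d^2\ge K^{-1}$; (v) $(d_i)_{i\le n}$ is independent of $(\varepsilon_i)_{i\le n}$. 2. (i) $\lambda_{\min}\big(n^{-1}\sum_{i=1}^n w_iw_i^\top\big)\ge K^{-1}+o_p(1)$,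 where $\lambda_{\min}$ is the smallest eigenvalue; (ii) $\max_{i\le n}\mathbb E[\|w_i\|^2]\le K$; (iii) the first component of the vectors $w_i$, $1\le i\le n$, is a non-zero constant (the same for all $i\le n$). 3. (i) $n^{-1}\sum_{i=1}^n w_i\varepsilon_i=o_p(1)$; (ii) $n^{-1}\sum_{i=1}^n\varepsilon_i^2=n^{-1}\sum_{i=1}^n\mathbb E[\varepsilon_i^2]+o_p(1)$; (iii) $\max_{i\le n}\mathbb E[|\varepsilon_i|^{2+\delta_2}]\le K$; (iv) $n^{-1}\sum_{i=1}^n\mathbb E[\varepsilon_i^2]\ge K^{-1}$. No other restriction is placed on the joint distribution of $(w_i,\varepsilon_i)_{i\le n}$. Let $\hat\beta$ be the first component of the least squares estimator $(\mathbf X^\top\mathbf X)^{-1}\mathbf X^\top\mathbf Y$, where $\mathbf X$ has rows $(d_i,w_i^\top)$ and $\mathbf Y=(y_i)_{i\le n}$ (the inverse is read as $0$ if $\mathbf X^\top\mathbf X$ is singular). Put $d_i^*=d_i-\mu_d$, $\sigma_d=\sqrt{\sigma_d^2}$, and let $\sigma_\varepsilon>0$ be given by $\sigma_\varepsilon^2=n^{-1}\sum_{i=1}^n\operatorname{Var}(\varepsilon_i)$.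 Then $$\frac{\sqrt n(\hat\beta-\beta)}{\sigma_\varepsilon/\sigma_d}=\frac{n^{-1/2}\sum_{i=1}^n d_i^*\varepsilon_i}{\sigma_d\sigma_\varepsilon}+o_p(1)\ \to_d\ N(0,1).$$ -/

import Mathlib

open MeasureTheory ProbabilityTheory Filter
open scoped Topology Matrix

/-- The design matrix `X = (D, W)` of a sample of size `n`: its column `Sum.inl ()` is the regressor
of interest `D = (d_i)` and its columns `Sum.inr j` are the controls, so that row `i` is
`x_i = (d_i, w_iᵀ)`. -/
def designMatrix {n q : ℕ} (d : Fin n → ℝ) (w : Fin n → EuclideanSpace ℝ (Fin q)) :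
    Matrix (Fin n) (Unit ⊕ Fin q) ℝ :=
  Matrix.fromCols (Matrix.replicateCol Unit d) (Matrix.of fun i j => w i j)

/-- The least squares coefficient vector `(XᵀX)⁻¹ XᵀY`. -/
noncomputable def olsCoef {n : ℕ} {κ : Type*} [Fintype κ] [DecidableEq κ]
    (X : Matrix (Fin n) κ ℝ) (Y : Fin n → ℝ) : κ → ℝ :=
  (Xᵀ * X)⁻¹ *ᵥ (Xᵀ *ᵥ Y)

/-- The least squares estimator `β̂` of the coefficient on the regressor of interest, in the
regression of `y_i` on `(d_i, w_iᵀ)`. -/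
noncomputable def betaHat {n q : ℕ} (d : Fin n → ℝ) (w : Fin n → EuclideanSpace ℝ (Fin q))
    (y : Fin n → ℝ) : ℝ :=
  olsCoef (designMatrix d w) y (Sum.inl ())

/-- The matrix `n⁻¹ ∑ᵢ wᵢ wᵢᵀ`. -/
noncomputable def controlGram {n q : ℕ} (w : Fin n → EuclideanSpace ℝ (Fin q)) :
    Matrix (Fin q) (Fin q) ℝ :=
  (n : ℝ)⁻¹ • ∑ i, Matrix.vecMulVec (fun j => w i j) (fun j => w i j)

/-- The smallest (real) eigenvalue of a square matrix; it is used for symmetric matrices of size at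
least one, whose spectrum over `ℝ` is a nonempty finite set. -/
noncomputable def lambdaMin {q : ℕ} (A : Matrix (Fin q) (Fin q) ℝ) : ℝ :=
  sInf (spectrum ℝ A)

/-- `X n = o_p(1)`: the sequence `X` converges to zero in probability. -/
def IsLittleOp {Ω E : Type*} [MeasurableSpace Ω] [NormedAddCommGroup E] (P : Measure Ω)
    (X : ℕ → Ω → E) : Prop :=
  TendstoInMeasure P X atTop (fun _ => 0)

/-- `σ_ε = (n⁻¹ ∑ᵢ Var(εᵢ))^{1/2}`. -/
noncomputable def sigmaEps {Ω : Type*} [MeasurableSpace Ω] (P : Measure Ω) {n : ℕ}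
    (ε : Fin n → Ω → ℝ) : ℝ :=
  √((n : ℝ)⁻¹ * ∑ i, Var[ε i; P])

/-! ### Calculus of convergence in probability. -/

section LittleOp

variable {Ω : Type*} [MeasurableSpace Ω] {P : Measure Ω}

/-! The first control is a nonzero constant, so centring `d` only moves the intercept and the
regressor may be replaced by `z = (d - μd) / σd`. Put `b = σd (β̂ - β)`, let `f` be the resulting
error in the control coefficients, and set `a = n^{-1/2} ∑ zᵢ wᵢ`, `g = n⁻¹ ∑ εᵢ wᵢ`. The normal
equation for `z` says exactly that `(n⁻¹ ∑ zᵢ²) √n b - n^{-1/2} ∑ zᵢ εᵢ = -⟨a, f⟩`. The equations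
for `w`, paired with `f`, and the lower bound `c` on the Gram matrix give `‖f‖ ≤ (‖g‖ + ‖a‖ |√n b| /
n) / c`.

Since `z` is centred and independent of `w`, `E‖a‖²` is bounded whatever the dependence among the
controls, while `g = o_p(1)` by assumption. Hence `⟨a, f⟩` is at most `‖a‖ ‖g‖ / c = o_p(1)` plus an
`o_p(1)` multiple of `|√n b|`, which is absorbed on the left. With `n⁻¹ ∑ zᵢ² → 1`, this is the
linear representation (`abs_betaHat_sub_le`, `abs_sub_le_of_abs_mul_sub_le`,
`isLittleOp_mean_sq_sub_one`).

The leading term is `∑ Zᵢ Vᵢ` with `Z` i.i.d. and standardized, and weights `V`, the normalized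
errors, independent of `Z` but arbitrarily dependent among themselves. Given `V`, its characteristic
function is a product close to `exp(-t² ∑ Vᵢ² / 2)`; since `∑ Vᵢ² → 1` in probability, averaging
over `V` gives the normal limit (`tendstoInDistribution_sum_mul_of_indepFun`). Slutsky's lemma
concludes. -/

theorem isLittleOp_iff {E : Type*} [NormedAddCommGroup E] {X : ℕ → Ω → E} :
    IsLittleOp P X ↔ ∀ δ : ℝ, 0 < δ → Tendsto (fun n => P {ω | δ ≤ ‖X n ω‖}) atTop (𝓝 0) := by
  simp [IsLittleOp, tendstoInMeasure_iff_norm]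

/-- A sequence that is, eventually and outside exceptional sets of vanishing probability, dominated
by an `o_p(1)` sequence is `o_p(1)`. -/
theorem IsLittleOp.of_norm_le_off {E F : Type*} [NormedAddCommGroup E] [NormedAddCommGroup F]
    {X : ℕ → Ω → E} {Y : ℕ → Ω → F} (hY : IsLittleOp P Y) {B : ℕ → Set Ω}
    (hB : Tendsto (fun n => P (B n)) atTop (𝓝 0))
    (h : ∀ᶠ n in atTop, ∀ᵐ ω ∂P, ω ∉ B n → ‖X n ω‖ ≤ ‖Y n ω‖) : IsLittleOp P X := by
  rw [isLittleOp_iff] at hY ⊢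
  intro δ hδ
  have hlim := (hY δ hδ).add hB
  rw [add_zero] at hlim
  refine tendsto_of_tendsto_of_tendsto_of_le_of_le' tendsto_const_nhds hlim
    (Eventually.of_forall fun _ => zero_le) ?_
  filter_upwards [h] with n hn
  refine le_trans (measure_mono_ae ?_) (measure_union_le _ _)
  filter_upwards [hn] with ω hω hX
  by_cases hb : ω ∈ B n
  · exact Or.inr hb
  · exact Or.inl (le_trans (show δ ≤ ‖X n ω‖ from hX) (hω hb))

theorem IsLittleOp.of_norm_le {E F : Type*} [NormedAddCommGroup E] [NormedAddCommGroup F]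
    {X : ℕ → Ω → E} {Y : ℕ → Ω → F} (hY : IsLittleOp P Y)
    (h : ∀ᶠ n in atTop, ∀ᵐ ω ∂P, ‖X n ω‖ ≤ ‖Y n ω‖) : IsLittleOp P X :=
  hY.of_norm_le_off (B := fun _ => ∅) (by simp) (h.mono fun _ hn => hn.mono fun _ hω _ => hω)

theorem IsLittleOp.add {E : Type*} [NormedAddCommGroup E] {X Y : ℕ → Ω → E}
    (hX : IsLittleOp P X) (hY : IsLittleOp P Y) : IsLittleOp P fun n ω => X n ω + Y n ω := by
  rw [isLittleOp_iff] at hX hY ⊢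
  intro δ hδ
  have hlim := (hX (δ / 2) (by positivity)).add (hY (δ / 2) (by positivity))
  rw [add_zero] at hlim
  refine tendsto_of_tendsto_of_tendsto_of_le_of_le tendsto_const_nhds hlim
    (fun _ => zero_le) fun n => ?_
  refine le_trans (measure_mono fun ω hω => ?_) (measure_union_le _ _)
  by_contra hc
  simp only [Set.mem_union, Set.mem_ofPred_eq, not_or, not_le] at hc hω
  linarith [norm_add_le (X n ω) (Y n ω)]

theorem IsLittleOp.const_mul {X : ℕ → Ω → ℝ} (hX : IsLittleOp P X) (c : ℝ) :
    IsLittleOp P fun n ω => c * X n ω := by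
  rw [isLittleOp_iff] at hX ⊢
  intro δ hδ
  have hc : 0 < |c| + 1 := by positivity
  refine tendsto_of_tendsto_of_tendsto_of_le_of_le tendsto_const_nhds
    (hX (δ / (|c| + 1)) (by positivity)) (fun _ => zero_le) fun n => measure_mono fun ω hω => ?_
  simp only [Set.mem_ofPred_eq, norm_mul, Real.norm_eq_abs] at hω ⊢
  rw [div_le_iff₀ hc]
  nlinarith [abs_nonneg (X n ω)]

theorem IsLittleOp.norm {E : Type*} [NormedAddCommGroup E] {X : ℕ → Ω → E}
    (hX : IsLittleOp P X) : IsLittleOp P fun n ω => ‖X n ω‖ :=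
  hX.of_norm_le (Eventually.of_forall fun _ => Eventually.of_forall fun _ => by simp)

theorem measure_le_norm_le_integral_div [IsFiniteMeasure P] {E : Type*} [NormedAddCommGroup E]
    {X : Ω → E} (hX : Integrable X P) {δ : ℝ} (hδ : 0 < δ) :
    P {ω | δ ≤ ‖X ω‖} ≤ ENNReal.ofReal ((∫ ω, ‖X ω‖ ∂P) / δ) := by
  rw [← ofReal_measureReal]
  refine ENNReal.ofReal_le_ofReal ?_
  rw [le_div_iff₀ hδ, mul_comm]
  exact mul_meas_ge_le_integral_of_nonneg (Eventually.of_forall fun _ => norm_nonneg _) hX.norm δ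

theorem isLittleOp_of_tendsto_integral_norm [IsFiniteMeasure P] {E : Type*} [NormedAddCommGroup E]
    {X : ℕ → Ω → E} (hX : ∀ n, Integrable (X n) P)
    (h : Tendsto (fun n => ∫ ω, ‖X n ω‖ ∂P) atTop (𝓝 0)) : IsLittleOp P X := by
  rw [isLittleOp_iff]
  intro δ hδ
  have hlim : Tendsto (fun n => ENNReal.ofReal ((∫ ω, ‖X n ω‖ ∂P) / δ)) atTop (𝓝 0) := by
    simpa using ENNReal.tendsto_ofReal (h.div_const δ)
  exact tendsto_of_tendsto_of_tendsto_of_le_of_le tendsto_const_nhds hlim (fun _ => zero_le)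
    fun n => measure_le_norm_le_integral_div (hX n) hδ

theorem isLittleOp_of_tendsto_integral_sq [IsFiniteMeasure P] {X : ℕ → Ω → ℝ}
    (hX : ∀ n, Integrable (fun ω => X n ω ^ 2) P)
    (h : Tendsto (fun n => ∫ ω, X n ω ^ 2 ∂P) atTop (𝓝 0)) : IsLittleOp P X := by
  have hsq : IsLittleOp P fun n ω => X n ω ^ 2 :=
    isLittleOp_of_tendsto_integral_norm hX (by simpa using h)
  rw [isLittleOp_iff] at hsq ⊢
  intro δ hδ
  refine tendsto_of_tendsto_of_tendsto_of_le_of_le tendsto_const_nhds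
    (hsq (δ ^ 2) (by positivity)) (fun _ => zero_le) fun n => measure_mono fun ω hω => ?_
  simp only [Set.mem_ofPred_eq, norm_pow] at hω ⊢
  gcongr

/-- The product of an `o_p(1)` sequence and a sequence with bounded second moments is `o_p(1)`. -/
theorem IsLittleOp.mul_of_integral_sq_le [IsFiniteMeasure P] {X Y : ℕ → Ω → ℝ}
    (hX : IsLittleOp P X) {C : ℝ} (hY : ∀ᶠ n in atTop, Integrable (fun ω => Y n ω ^ 2) P)
    (hC : ∀ᶠ n in atTop, ∫ ω, Y n ω ^ 2 ∂P ≤ C) : IsLittleOp P fun n ω => X n ω * Y n ω := by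
  rw [isLittleOp_iff] at hX ⊢
  intro δ hδ
  rw [ENNReal.tendsto_nhds_zero]
  intro η hη
  -- `M` is a level that `|Y n|` exceeds with probability at most `C / M²`; below it, a product of
  -- size `δ` forces `|X n| ≥ δ / M`.
  obtain ⟨M, hM, hMη⟩ : ∃ M : ℝ, 0 < M ∧ ENNReal.ofReal (C / M ^ 2) ≤ η / 2 := by
    have hlim : Tendsto (fun M : ℝ => ENNReal.ofReal (C / M ^ 2)) atTop (𝓝 0) := by
      simpa using ENNReal.tendsto_ofReal
        (tendsto_const_nhds.div_atTop (tendsto_pow_atTop (α := ℝ) two_ne_zero) :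
          Tendsto (fun M : ℝ => C / M ^ 2) atTop (𝓝 0))
    have hη2 : 0 < η / 2 := ENNReal.div_pos hη.ne' (by simp)
    obtain ⟨M, h1, h2⟩ := ((ENNReal.tendsto_nhds_zero.1 hlim (η / 2) hη2).and
      (eventually_gt_atTop 0)).exists
    exact ⟨M, h2, h1⟩
  have hη2 : 0 < η / 2 := ENNReal.div_pos hη.ne' (by simp)
  filter_upwards [hY, hC, ENNReal.tendsto_nhds_zero.1 (hX (δ / M) (by positivity)) _ hη2]
    with n hYn hCn hXn
  calc P {ω | δ ≤ ‖X n ω * Y n ω‖}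
      ≤ P ({ω | δ / M ≤ ‖X n ω‖} ∪ {ω | M ^ 2 ≤ ‖Y n ω ^ 2‖}) := by
        refine measure_mono fun ω hω => ?_
        by_contra hc
        simp only [Set.mem_union, Set.mem_ofPred_eq, not_or, not_le, norm_mul, norm_pow] at hc hω
        have hY1 : ‖Y n ω‖ < M := lt_of_pow_lt_pow_left₀ 2 hM.le hc.2
        have hX1 := (lt_div_iff₀ hM).1 hc.1
        have := mul_le_mul_of_nonneg_left hY1.le (norm_nonneg (X n ω))
        linarith
    _ ≤ P {ω | δ / M ≤ ‖X n ω‖} + P {ω | M ^ 2 ≤ ‖Y n ω ^ 2‖} := measure_union_le _ _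
    _ ≤ η / 2 + η / 2 := by
        gcongr
        refine (measure_le_norm_le_integral_div hYn (by positivity)).trans
          (le_trans (ENNReal.ofReal_le_ofReal ?_) hMη)
        gcongr
        simpa using hCn
    _ = η := ENNReal.add_halves η

end LittleOp

/-! ### Characteristic function estimates. -/

section CharFun

/-- Factors are exchanged one at a time; the others lie in the unit ball, so errors add without
amplification. -/
theorem norm_prod_sub_prod_le {ι R : Type*} [NormedCommRing R] [NormOneClass R]
    (s : Finset ι) (a b : ι → R) (ha : ∀ i ∈ s, ‖a i‖ ≤ 1) (hb : ∀ i ∈ s, ‖b i‖ ≤ 1) :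
    ‖∏ i ∈ s, a i - ∏ i ∈ s, b i‖ ≤ ∑ i ∈ s, ‖a i - b i‖ := by
  classical
  induction s using Finset.induction_on with
  | empty => simp
  | insert i s hi ih =>
    simp only [Finset.mem_insert, forall_eq_or_imp] at ha hb
    rw [Finset.prod_insert hi, Finset.prod_insert hi, Finset.sum_insert hi]
    have hprod : ‖∏ i ∈ s, b i‖ ≤ 1 :=
      (Finset.norm_prod_le _ _).trans (Finset.prod_le_one (fun _ _ => norm_nonneg _) hb.2)
    calc ‖a i * ∏ i ∈ s, a i - b i * ∏ i ∈ s, b i‖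
        = ‖(a i - b i) * ∏ i ∈ s, b i + a i * (∏ i ∈ s, a i - ∏ i ∈ s, b i)‖ := by ring_nf
      _ ≤ ‖a i - b i‖ * ‖∏ i ∈ s, b i‖ + ‖a i‖ * ‖∏ i ∈ s, a i - ∏ i ∈ s, b i‖ :=
        (norm_add_le _ _).trans (add_le_add (norm_mul_le _ _) (norm_mul_le _ _))
      _ ≤ ‖a i - b i‖ * 1 + 1 * ∑ i ∈ s, ‖a i - b i‖ := by
        gcongr
        · exact ha.1
        · exact ih ha.2 hb.2
      _ = _ := by ring

/-- For `|x| ≤ 1` the Taylor remainder is cubic and `|x|³ ≤ |x|^p`; for `|x| > 1` the four terms are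
bounded separately by multiples of `x² ≤ |x|^p`. This is where `2 ≤ p ≤ 3` enters. -/
theorem norm_cexp_mul_I_sub_taylor_two_le {p : ℝ} (hp2 : 2 ≤ p) (hp3 : p ≤ 3) (x : ℝ) :
    ‖Complex.exp (x * Complex.I) - (1 + x * Complex.I - x ^ 2 / 2)‖ ≤ 4 * |x| ^ p := by
  rcases le_or_gt |x| 1 with hx | hx
  · have hb := Complex.exp_bound (x := x * Complex.I) (by simpa using hx) (n := 3) (by norm_num)
    have hsum : ∑ m ∈ Finset.range 3, (x * Complex.I) ^ m / (m.factorial : ℂ)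
        = 1 + x * Complex.I - x ^ 2 / 2 := by
      simp [Finset.sum_range_succ, mul_pow]
      ring
    rw [hsum] at hb
    have hpow : |x| ^ (3 : ℕ) ≤ |x| ^ p := by
      rw [← Real.rpow_natCast]
      exact Real.rpow_le_rpow_of_exponent_ge' (abs_nonneg x) hx (by linarith) (by simpa using hp3)
    refine hb.trans ?_
    have : ‖(x * Complex.I : ℂ)‖ = |x| := by simp
    rw [this]
    norm_num [Nat.factorial]
    nlinarith [pow_nonneg (abs_nonneg x) 3]
  · have hpow : |x| ^ (2 : ℕ) ≤ |x| ^ p := by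
      rw [← Real.rpow_natCast]
      exact Real.rpow_le_rpow_of_exponent_le hx.le (by simpa using hp2)
    calc ‖Complex.exp (x * Complex.I) - (1 + x * Complex.I - x ^ 2 / 2)‖
        ≤ ‖Complex.exp (x * Complex.I)‖ + (‖(1 : ℂ)‖ + ‖(x * Complex.I : ℂ)‖
            + ‖(x ^ 2 / 2 : ℂ)‖) :=
          (norm_sub_le _ _).trans (add_le_add le_rfl ((norm_sub_le _ _).trans
            (add_le_add (norm_add_le _ _) le_rfl)))
      _ = 1 + (1 + |x| + |x| ^ 2 / 2) := by
          rw [Complex.norm_exp_ofReal_mul_I]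
          simp
      _ ≤ 4 * |x| ^ p := by nlinarith

theorem norm_one_sub_sub_exp_neg_le {p : ℝ} (hp2 : 2 ≤ p) (hp3 : p ≤ 3) (s : ℝ) :
    |1 - s ^ 2 / 2 - Real.exp (-s ^ 2 / 2)| ≤ |s| ^ p := by
  have h1 : Real.exp (-s ^ 2 / 2) ≤ 1 := Real.exp_le_one_iff.2 (by nlinarith [sq_nonneg s])
  have h2 := Real.add_one_le_exp (-s ^ 2 / 2)
  rw [abs_sub_comm, abs_of_nonneg (by linarith)]
  rcases le_or_gt |s| 1 with hs | hs
  · have hpow : |s| ^ (3 : ℕ) ≤ |s| ^ p := by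
      rw [← Real.rpow_natCast]
      exact Real.rpow_le_rpow_of_exponent_ge' (abs_nonneg s) hs (by linarith) (by simpa using hp3)
    have hb := Real.norm_exp_sub_one_sub_id_le (x := -s ^ 2 / 2) (by
      rw [Real.norm_eq_abs, abs_le]; constructor <;> nlinarith [sq_abs s, abs_nonneg s])
    have hs4 : |s| ^ 4 ≤ |s| ^ 3 := pow_le_pow_of_le_one (abs_nonneg s) hs (by norm_num)
    have h4 : ‖-s ^ 2 / 2‖ ^ 2 = |s| ^ 4 / 4 := by
      rw [Real.norm_eq_abs, sq_abs, Even.pow_abs (by decide : Even 4) s]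
      ring
    rw [h4] at hb
    have := le_abs_self (Real.exp (-s ^ 2 / 2) - 1 - -s ^ 2 / 2)
    rw [← Real.norm_eq_abs] at this
    nlinarith [pow_nonneg (abs_nonneg s) 3]
  · have hpow : |s| ^ (2 : ℕ) ≤ |s| ^ p := by
      rw [← Real.rpow_natCast]
      exact Real.rpow_le_rpow_of_exponent_le hs.le (by simpa using hp2)
    rw [sq_abs] at hpow
    nlinarith [sq_nonneg s]

variable {Ω : Type*} [MeasurableSpace Ω] {P : Measure Ω} [IsProbabilityMeasure P]

theorem integrable_of_integrable_abs_rpow {X : Ω → ℝ} (hX : Measurable X) {p q : ℝ} (hq : 0 ≤ q)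
    (hqp : q ≤ p) (hp : Integrable (fun ω => |X ω| ^ p) P) :
    Integrable (fun ω => |X ω| ^ q) P := by
  refine ((integrable_const (1 : ℝ)).add hp).mono' (by fun_prop) (Eventually.of_forall fun ω => ?_)
  rw [Real.norm_of_nonneg (by positivity)]
  simp only [Pi.add_apply]
  rcases le_or_gt |X ω| 1 with h | h
  · have := Real.rpow_le_one (abs_nonneg (X ω)) h hq
    have := Real.rpow_nonneg (abs_nonneg (X ω)) p
    linarith
  · have := Real.rpow_le_rpow_of_exponent_le h.le hqp
    linarith

theorem integrable_sq_of_integrable_abs_rpow {X : Ω → ℝ} (hX : Measurable X) {p : ℝ}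
    (hp2 : 2 ≤ p) (hp : Integrable (fun ω => |X ω| ^ p) P) :
    Integrable (fun ω => X ω ^ 2) P := by
  have := integrable_of_integrable_abs_rpow hX (by norm_num : (0 : ℝ) ≤ 2) hp2 hp
  simpa using this

theorem memLp_two_of_integrable_abs_rpow {X : Ω → ℝ} (hX : Measurable X) {p : ℝ}
    (hp2 : 2 ≤ p) (hp : Integrable (fun ω => |X ω| ^ p) P) : MemLp X 2 P :=
  (memLp_two_iff_integrable_sq hX.aestronglyMeasurable).2
    (integrable_sq_of_integrable_abs_rpow hX hp2 hp)

/-- A centred variable with unit variance has a characteristic function that agrees with the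
Gaussian one up to the order of its highest moment. -/
theorem norm_charFun_sub_exp_le {X : Ω → ℝ} (hX : Measurable X) (h0 : ∫ ω, X ω ∂P = 0)
    (h1 : ∫ ω, X ω ^ 2 ∂P = 1) {p : ℝ} (hp2 : 2 ≤ p) (hp3 : p ≤ 3)
    (hp : Integrable (fun ω => |X ω| ^ p) P) (s : ℝ) :
    ‖charFun (P.map X) s - (Real.exp (-s ^ 2 / 2) : ℂ)‖
      ≤ (4 * ∫ ω, |X ω| ^ p ∂P + 1) * |s| ^ p := by
  have hL2 := memLp_two_of_integrable_abs_rpow hX hp2 hp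
  have hI : Integrable X P := hL2.integrable (by norm_num)
  have hI2 := hL2.integrable_sq
  have hcf : charFun (P.map X) s = ∫ ω, Complex.exp ((s * X ω : ℝ) * Complex.I) ∂P := by
    rw [charFun_apply_real, integral_map hX.aemeasurable (by fun_prop)]
    simp
  have hT1 : Integrable (fun ω => ((s * X ω : ℝ) : ℂ) * Complex.I) P :=
    ((hI.const_mul s).ofReal).mul_const _
  have hT2 : Integrable (fun ω => ((s * X ω : ℝ) : ℂ) ^ 2 / 2) P := by
    have : Integrable (fun ω => (((s ^ 2 * X ω ^ 2 : ℝ)) : ℂ) / 2) P :=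
      ((hI2.const_mul (s ^ 2)).ofReal).div_const _
    refine this.congr (Eventually.of_forall fun ω => ?_)
    push_cast; ring
  have hT12 : Integrable (fun ω => 1 + ((s * X ω : ℝ) : ℂ) * Complex.I) P :=
    (integrable_const _).add hT1
  have hT : ∫ ω, (1 + ((s * X ω : ℝ) : ℂ) * Complex.I - ((s * X ω : ℝ) : ℂ) ^ 2 / 2) ∂P
      = ((1 - s ^ 2 / 2 : ℝ) : ℂ) := by
    rw [integral_sub hT12 hT2, integral_add (integrable_const _) hT1,
      integral_mul_const, integral_complex_ofReal, integral_const_mul, h0]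
    have : ∫ ω, ((s * X ω : ℝ) : ℂ) ^ 2 / 2 ∂P = ((s ^ 2 / 2 : ℝ) : ℂ) := by
      have : ∀ ω, ((s * X ω : ℝ) : ℂ) ^ 2 / 2 = ((s ^ 2 / 2 * X ω ^ 2 : ℝ) : ℂ) := by
        intro ω; push_cast; ring
      simp_rw [this]
      rw [integral_complex_ofReal, integral_const_mul, h1, mul_one]
    rw [this]
    simp
  have hexp : Integrable (fun ω => Complex.exp ((s * X ω : ℝ) * Complex.I)) P := by
    refine Integrable.of_bound (by fun_prop) 1 (Eventually.of_forall fun ω => ?_)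
    rw [Complex.norm_exp_ofReal_mul_I]
  -- Zero mean and unit variance make `1 - s² / 2` the expectation of the Taylor polynomial, so only
  -- the remainder is left to integrate.
  have hfirst : ‖charFun (P.map X) s - ((1 - s ^ 2 / 2 : ℝ) : ℂ)‖
      ≤ 4 * (∫ ω, |X ω| ^ p ∂P) * |s| ^ p := by
    rw [hcf, ← hT]
    have hsub := integral_sub hexp (hT12.sub hT2)
    simp only [Pi.sub_apply] at hsub
    rw [← hsub]
    calc _ ≤ ∫ ω, 4 * |s| ^ p * |X ω| ^ p ∂P := by
          refine norm_integral_le_of_norm_le (hp.const_mul _) (Eventually.of_forall fun ω => ?_)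
          have := norm_cexp_mul_I_sub_taylor_two_le hp2 hp3 (s * X ω)
          rwa [abs_mul, Real.mul_rpow (abs_nonneg _) (abs_nonneg _), ← mul_assoc] at this
      _ = _ := by rw [integral_const_mul]; ring
  calc _ = ‖(charFun (P.map X) s - ((1 - s ^ 2 / 2 : ℝ) : ℂ))
        + ((1 - s ^ 2 / 2 - Real.exp (-s ^ 2 / 2) : ℝ) : ℂ)‖ := by
        congr 1; push_cast; ring
    _ ≤ 4 * (∫ ω, |X ω| ^ p ∂P) * |s| ^ p + |s| ^ p := by
        refine (norm_add_le _ _).trans (add_le_add hfirst ?_)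
        rw [Complex.norm_real]
        exact norm_one_sub_sub_exp_neg_le hp2 hp3 s
    _ = _ := by ring

/-- Fubini on the product law of `(V, Z)`: for frozen weights the sum has independent terms and its
characteristic function factors. Nothing is needed about the joint law of the weights. -/
theorem charFun_map_sum_mul_of_indepFun {ι : Type*} [Fintype ι] {Z V : ι → Ω → ℝ}
    (hZ : ∀ i, Measurable (Z i)) (hV : ∀ i, Measurable (V i)) (hind : iIndepFun Z P)
    (hZV : IndepFun (fun ω i => Z i ω) (fun ω i => V i ω) P) (t : ℝ) :
    charFun (P.map fun ω => ∑ i, Z i ω * V i ω) t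
      = ∫ ω, ∏ i, charFun (P.map (Z i)) (t * V i ω) ∂P := by
  have hZm : Measurable fun ω i => Z i ω := measurable_pi_lambda _ hZ
  have hVm : Measurable fun ω i => V i ω := measurable_pi_lambda _ hV
  have hmap := (indepFun_iff_map_prod_eq_prod_map_map hVm.aemeasurable hZm.aemeasurable).1 hZV.symm
  have : IsProbabilityMeasure (P.map fun ω i => Z i ω) :=
    Measure.isProbabilityMeasure_map hZm.aemeasurable
  have : IsProbabilityMeasure (P.map fun ω i => V i ω) :=
    Measure.isProbabilityMeasure_map hVm.aemeasurable
  let F : (ι → ℝ) × (ι → ℝ) → ℂ := fun q =>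
    Complex.exp ((∑ i, t * q.1 i * q.2 i : ℝ) * Complex.I)
  have hF : Measurable F := by fun_prop
  have hinner : ∀ v : ι → ℝ, ∫ z, F (v, z) ∂(P.map fun ω i => Z i ω)
      = ∏ i, charFun (P.map (Z i)) (t * v i) := by
    intro v
    have hind' : iIndepFun (fun i ω => t * v i * Z i ω) P :=
      hind.comp (fun i x => t * v i * x) (fun i => by fun_prop)
    have hcf := congrFun (hind'.charFun_map_fun_sum_eq_prod
      (fun i => ((hZ i).const_mul _).aemeasurable)) 1
    rw [integral_map hZm.aemeasurable (by fun_prop)]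
    rw [charFun_apply_real, integral_map (by fun_prop) (by fun_prop)] at hcf
    simp only [Finset.prod_apply] at hcf
    simp_rw [charFun_map_mul_comp (hZ _).aemeasurable, mul_one] at hcf
    rw [← hcf]
    simp [F]
  calc charFun (P.map fun ω => ∑ i, Z i ω * V i ω) t
      = ∫ ω, F ((fun i => V i ω), (fun i => Z i ω)) ∂P := by
        rw [charFun_apply_real, integral_map (by fun_prop) (by fun_prop)]
        refine integral_congr_ae (Eventually.of_forall fun ω => ?_)
        simp only [F, Finset.mul_sum, Complex.ofReal_sum, Complex.ofReal_mul]
        congr 2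
        exact Finset.sum_congr rfl fun i _ => by ring
    _ = ∫ q, F q ∂((P.map fun ω i => V i ω).prod (P.map fun ω i => Z i ω)) := by
        rw [← hmap, integral_map (hVm.prodMk hZm).aemeasurable hF.aestronglyMeasurable]
    _ = ∫ v, ∏ i, charFun (P.map (Z i)) (t * v i) ∂(P.map fun ω i => V i ω) := by
        rw [integral_prod _ (Integrable.of_bound hF.aestronglyMeasurable 1
          (Eventually.of_forall fun q => by simp only [F, Complex.norm_exp_ofReal_mul_I, le_refl]))]
        simp_rw [hinner]
    _ = _ := by
        rw [integral_map hVm.aemeasurable]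
        exact (Finset.measurable_prod _ fun i _ =>
          measurable_charFun.comp (by fun_prop)).aestronglyMeasurable

end CharFun

/-! ### Central limit theorem with independent random weights. -/

section CentralLimit

variable {Ω : Type*} [MeasurableSpace Ω] {P : Measure Ω} [IsProbabilityMeasure P]

/-- Bounded convergence: the integrand is at most `δ / 2`, except on an event of small probability
where it is at most `1`. -/
theorem IsLittleOp.tendsto_integral_abs {X : ℕ → Ω → ℝ} (hX : IsLittleOp P X)
    (hm : ∀ n, Measurable (X n)) (hb : ∀ n ω, |X n ω| ≤ 1) :
    Tendsto (fun n => ∫ ω, |X n ω| ∂P) atTop (𝓝 0) := by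
  have hint : ∀ n, Integrable (fun ω => |X n ω|) P := fun n =>
    Integrable.of_bound (by fun_prop) 1 (Eventually.of_forall fun ω => by simpa using hb n ω)
  rw [Metric.tendsto_nhds]
  intro δ hδ
  have hX' := (tendstoInMeasure_iff_measureReal_norm.1 hX) (δ / 2) (by positivity)
  filter_upwards [hX'.eventually_lt_const (show (0 : ℝ) < δ / 2 by positivity)] with n hn
  simp only [sub_zero] at hn
  rw [Real.dist_eq, sub_zero, abs_of_nonneg (integral_nonneg fun _ => abs_nonneg _)]
  have hS : MeasurableSet {ω | δ / 2 ≤ ‖X n ω‖} :=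
    measurableSet_le measurable_const (hm n).norm
  have hle : ∫ ω, |X n ω| ∂P
      ≤ ∫ ω, (δ / 2 + Set.indicator {ω | δ / 2 ≤ ‖X n ω‖} (fun _ => (1 : ℝ)) ω) ∂P := by
    refine integral_mono (hint n)
      ((integrable_const _).add ((integrable_const _).indicator hS)) fun ω => ?_
    simp only
    by_cases h : δ / 2 ≤ ‖X n ω‖
    · rw [Set.indicator_of_mem (by exact h)]
      linarith [hb n ω]
    · rw [Set.indicator_of_notMem (by exact h)]
      rw [Real.norm_eq_abs] at h
      linarith
  rw [integral_add (integrable_const _) ((integrable_const _).indicator hS),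
    integral_indicator_const _ hS] at hle
  simp at hle hn
  linarith

theorem abs_exp_neg_sub_exp_neg_le {x y : ℝ} (hx : 0 ≤ x) (hy : 0 ≤ y) :
    |Real.exp (-x) - Real.exp (-y)| ≤ |x - y| := by
  wlog h : x ≤ y generalizing x y
  · rw [abs_sub_comm, abs_sub_comm x]
    exact this hy hx (le_of_not_ge h)
  have h1 : Real.exp (-y) ≤ Real.exp (-x) := Real.exp_le_exp.2 (by linarith)
  have h2 : Real.exp (-x) ≤ 1 := Real.exp_le_one_iff.2 (by linarith)
  have h3 := Real.add_one_le_exp (-(y - x))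
  have h4 : Real.exp (-y) = Real.exp (-x) * Real.exp (-(y - x)) := by
    rw [← Real.exp_add]; ring_nf
  rw [abs_of_nonneg (by linarith), abs_of_nonpos (by linarith), h4]
  nlinarith [Real.exp_pos (-x)]

/-- A central limit theorem for triangular arrays of independent, centred and standardized
variables with random weights that are independent of them. -/
theorem tendstoInDistribution_sum_mul_of_indepFun {Z V : (n : ℕ) → Fin n → Ω → ℝ}
    (hZ : ∀ n i, Measurable (Z n i)) (hV : ∀ n i, Measurable (V n i))
    (hind : ∀ n, iIndepFun (Z n) P)
    (hZV : ∀ n, IndepFun (fun ω i => Z n i ω) (fun ω i => V n i ω) P)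
    (h0 : ∀ n i, ∫ ω, Z n i ω ∂P = 0) (h1 : ∀ n i, ∫ ω, Z n i ω ^ 2 ∂P = 1)
    {p M : ℝ} (hp2 : 2 ≤ p) (hp3 : p ≤ 3) (hZp : ∀ n i, Integrable (fun ω => |Z n i ω| ^ p) P)
    (hZM : ∀ n i, ∫ ω, |Z n i ω| ^ p ∂P ≤ M)
    (hVp : ∀ n i, Integrable (fun ω => |V n i ω| ^ p) P)
    (hV0 : Tendsto (fun n => ∑ i, ∫ ω, |V n i ω| ^ p ∂P) atTop (𝓝 0))
    (hV1 : IsLittleOp P fun n ω => ∑ i, V n i ω ^ 2 - 1) :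
    TendstoInDistribution (fun n ω => ∑ i, Z n i ω * V n i ω) atTop (id : ℝ → ℝ) (fun _ => P)
      (gaussianReal 0 1) := by
  refine ⟨fun n => by fun_prop, by fun_prop, ?_⟩
  refine ProbabilityMeasure.tendsto_iff_tendsto_charFun.2 fun t => ?_
  simp only [ProbabilityMeasure.coe_mk, Measure.map_id, charFun_gaussianReal]
  -- The conditional Gaussian characteristic function, of variance `∑ Vᵢ²`, minus its target.
  set D : ℕ → Ω → ℝ := fun n ω =>
    Real.exp (-(t ^ 2 * (∑ i, V n i ω ^ 2) / 2)) - Real.exp (-(t ^ 2 / 2)) with hD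
  have hDm : ∀ n, Measurable (D n) := fun n => by fun_prop
  have hDb : ∀ n ω, |D n ω| ≤ 1 := by
    intro n ω
    have hs : 0 ≤ ∑ i, V n i ω ^ 2 := Finset.sum_nonneg fun _ _ => sq_nonneg _
    have ha : Real.exp (-(t ^ 2 * (∑ i, V n i ω ^ 2) / 2)) ≤ 1 :=
      Real.exp_le_one_iff.2 (by have := mul_nonneg (sq_nonneg t) hs; linarith)
    have hb : Real.exp (-(t ^ 2 / 2)) ≤ 1 := Real.exp_le_one_iff.2 (by nlinarith [sq_nonneg t])
    rw [abs_le]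
    constructor <;> simp only [hD] <;> linarith [Real.exp_pos (-(t ^ 2 * (∑ i, V n i ω ^ 2) / 2)),
      Real.exp_pos (-(t ^ 2 / 2))]
  have hDo : IsLittleOp P D := by
    refine (hV1.const_mul (t ^ 2 / 2)).of_norm_le
      (Eventually.of_forall fun n => Eventually.of_forall fun ω => ?_)
    have hs : 0 ≤ ∑ i, V n i ω ^ 2 := Finset.sum_nonneg fun _ _ => sq_nonneg _
    refine (abs_exp_neg_sub_exp_neg_le (by positivity) (by positivity)).trans (le_of_eq ?_)
    rw [Real.norm_eq_abs]
    congr 1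
    ring
  -- The first term is the cost of making each factor Gaussian, a Lyapunov sum; the second is the
  -- cost of replacing the random variance by one.
  have hlim : Tendsto (fun n => ((4 * M + 1) * |t| ^ p) * (∑ i, ∫ ω, |V n i ω| ^ p ∂P)
      + ∫ ω, |D n ω| ∂P) atTop (𝓝 0) := by
    simpa using (hV0.const_mul _).add (hDo.tendsto_integral_abs hDm hDb)
  rw [tendsto_iff_norm_sub_tendsto_zero]
  refine squeeze_zero (fun _ => norm_nonneg _) (fun n => ?_) hlim
  rw [charFun_map_sum_mul_of_indepFun (hZ n) (hV n) (hind n) (hZV n)]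
  have hφ1 : ∀ i s, ‖charFun (P.map (Z n i)) s‖ ≤ 1 := fun i s => by
    have : IsProbabilityMeasure (P.map (Z n i)) :=
      Measure.isProbabilityMeasure_map (hZ n i).aemeasurable
    exact norm_charFun_le_one (μ := P.map (Z n i)) s
  have hm : Measurable fun ω => ∏ i, charFun (P.map (Z n i)) (t * V n i ω) :=
    Finset.measurable_prod _ fun i _ => measurable_charFun.comp (by fun_prop)
  have hint : Integrable (fun ω => ∏ i, charFun (P.map (Z n i)) (t * V n i ω)) P :=
    Integrable.of_bound hm.aestronglyMeasurable 1 (Eventually.of_forall fun ω =>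
      (Finset.norm_prod_le _ _).trans (Finset.prod_le_one (fun _ _ => norm_nonneg _)
        fun i _ => hφ1 i _))
  have hconst : Complex.exp (t * (0 : ℝ) * Complex.I - ((1 : NNReal) : ℝ) * t ^ 2 / 2)
      = ∫ _, ((Real.exp (-(t ^ 2 / 2)) : ℝ) : ℂ) ∂P := by
    simp
  rw [hconst, ← integral_sub hint (integrable_const _)]
  have hbound : Integrable (fun ω => (∑ i, ((4 * M + 1) * |t| ^ p) * |V n i ω| ^ p) + |D n ω|) P :=
    (integrable_finsetSum _ fun i _ => (hVp n i).const_mul _).add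
      (Integrable.of_bound (by fun_prop) 1 (Eventually.of_forall fun ω => by simpa using hDb n ω))
  calc _ ≤ ∫ ω, ((∑ i, ((4 * M + 1) * |t| ^ p) * |V n i ω| ^ p) + |D n ω|) ∂P := by
        refine norm_integral_le_of_norm_le hbound (Eventually.of_forall fun ω => ?_)
        have hexp : ((Real.exp (-(t ^ 2 * (∑ i, V n i ω ^ 2) / 2)) : ℝ) : ℂ)
            = ∏ i, ((Real.exp (-(t * V n i ω) ^ 2 / 2) : ℝ) : ℂ) := by
          rw [← Complex.ofReal_prod, ← Real.exp_sum]
          congr 2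
          rw [Finset.mul_sum, Finset.sum_div, ← Finset.sum_neg_distrib]
          exact Finset.sum_congr rfl fun i _ => by ring
        calc _ = ‖(∏ i, charFun (P.map (Z n i)) (t * V n i ω)
                - ∏ i, ((Real.exp (-(t * V n i ω) ^ 2 / 2) : ℝ) : ℂ)) + (D n ω : ℂ)‖ := by
              rw [← hexp]
              congr 1
              simp only [hD, Complex.ofReal_sub]
              ring
          _ ≤ (∑ i, ‖charFun (P.map (Z n i)) (t * V n i ω)
                - ((Real.exp (-(t * V n i ω) ^ 2 / 2) : ℝ) : ℂ)‖) + |D n ω| := by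
              refine (norm_add_le _ _).trans (add_le_add ?_ (by simp))
              refine norm_prod_sub_prod_le _ _ _ (fun i _ => hφ1 i _) fun i _ => ?_
              rw [Complex.norm_real, Real.norm_of_nonneg (Real.exp_pos _).le]
              exact Real.exp_le_one_iff.2 (by nlinarith [sq_nonneg (t * V n i ω)])
          _ ≤ _ := by
              gcongr with i
              refine (norm_charFun_sub_exp_le (hZ n i) (h0 n i) (h1 n i) hp2 hp3 (hZp n i) _).trans ?_
              rw [abs_mul, Real.mul_rpow (abs_nonneg _) (abs_nonneg _), ← mul_assoc]
              gcongr
              exact hZM n i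
    _ = _ := by
        rw [integral_add (integrable_finsetSum _ fun i _ => (hVp n i).const_mul _)
          (Integrable.of_bound (by fun_prop) 1
            (Eventually.of_forall fun ω => by simpa using hDb n ω)),
          integral_finsetSum _ fun i _ => (hVp n i).const_mul _, Finset.mul_sum]
        simp_rw [integral_const_mul]

end CentralLimit

/-! ### Second moments of weighted sums and a weak law for squares. -/

section Moments

variable {Ω : Type*} [MeasurableSpace Ω] {P : Measure Ω}

theorem integral_mul_eq_ite_of_iIndepFun {ι : Type*} [DecidableEq ι] {Z : ι → Ω → ℝ}
    (hZ : ∀ i, Measurable (Z i)) (hind : iIndepFun Z P) (h0 : ∀ i, ∫ ω, Z i ω ∂P = 0)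
    (h1 : ∀ i, ∫ ω, Z i ω ^ 2 ∂P = 1) (i j : ι) :
    ∫ ω, Z i ω * Z j ω ∂P = if i = j then 1 else 0 := by
  split_ifs with h
  · subst h
    simp_rw [← sq, h1]
  · rw [(hind.indepFun h).integral_fun_mul_eq_mul_integral (hZ i).aestronglyMeasurable
      (hZ j).aestronglyMeasurable, h0, zero_mul]

/-- A weighted sum of standardized independent variables, with weights independent of them, has
second moment equal to the sum of the second moments of the weights. -/
theorem integral_sq_sum_mul_of_indepFun {ι : Type*} [Fintype ι] {Z V : ι → Ω → ℝ}
    (hZ : ∀ i, Measurable (Z i)) (hV : ∀ i, Measurable (V i)) (hind : iIndepFun Z P)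
    (hZV : IndepFun (fun ω i => Z i ω) (fun ω i => V i ω) P) (hZ2 : ∀ i, MemLp (Z i) 2 P)
    (h0 : ∀ i, ∫ ω, Z i ω ∂P = 0) (h1 : ∀ i, ∫ ω, Z i ω ^ 2 ∂P = 1)
    (hV2 : ∀ i, MemLp (V i) 2 P) :
    Integrable (fun ω => (∑ i, Z i ω * V i ω) ^ 2) P ∧
      ∫ ω, (∑ i, Z i ω * V i ω) ^ 2 ∂P = ∑ i, ∫ ω, V i ω ^ 2 ∂P := by
  classical
  have hexp : ∀ ω, (∑ i, Z i ω * V i ω) ^ 2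
      = ∑ i, ∑ j, (Z i ω * Z j ω) * (V i ω * V j ω) := by
    intro ω
    rw [sq, Finset.sum_mul_sum]
    exact Finset.sum_congr rfl fun i _ => Finset.sum_congr rfl fun j _ => by ring
  have hindp : ∀ i j, IndepFun (fun ω => Z i ω * Z j ω) (fun ω => V i ω * V j ω) P := fun i j =>
    hZV.comp (φ := fun z : ι → ℝ => z i * z j) (ψ := fun v : ι → ℝ => v i * v j)
      (by fun_prop) (by fun_prop)
  have hint : ∀ i j, Integrable (fun ω => (Z i ω * Z j ω) * (V i ω * V j ω)) P := fun i j =>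
    (hindp i j).integrable_mul ((hZ2 i).integrable_mul (hZ2 j)) ((hV2 i).integrable_mul (hV2 j))
  simp_rw [hexp]
  refine ⟨integrable_finsetSum _ fun i _ => integrable_finsetSum _ fun j _ => hint i j, ?_⟩
  rw [integral_finsetSum _ fun i _ => integrable_finsetSum _ fun j _ => hint i j]
  refine Finset.sum_congr rfl fun i _ => ?_
  rw [integral_finsetSum _ fun j _ => hint i j]
  have : ∀ j, ∫ ω, (Z i ω * Z j ω) * (V i ω * V j ω) ∂P
      = if i = j then ∫ ω, V i ω ^ 2 ∂P else 0 := by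
    intro j
    rw [(hindp i j).integral_fun_mul_eq_mul_integral (by fun_prop) (by fun_prop),
      integral_mul_eq_ite_of_iIndepFun hZ hind h0 h1]
    split_ifs with h
    · subst h
      simp_rw [one_mul, ← sq]
    · rw [zero_mul]
  simp_rw [this]
  simp

theorem integral_norm_sq_sum_smul_of_indepFun {ι : Type*} [Fintype ι] {q : ℕ} {Z : ι → Ω → ℝ}
    {W : ι → Ω → EuclideanSpace ℝ (Fin q)}
    (hZ : ∀ i, Measurable (Z i)) (hW : ∀ i, Measurable (W i)) (hind : iIndepFun Z P)
    (hZW : IndepFun (fun ω i => Z i ω) (fun ω i => W i ω) P) (hZ2 : ∀ i, MemLp (Z i) 2 P)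
    (h0 : ∀ i, ∫ ω, Z i ω ∂P = 0) (h1 : ∀ i, ∫ ω, Z i ω ^ 2 ∂P = 1)
    (hW2 : ∀ i, Integrable (fun ω => ‖W i ω‖ ^ 2) P) :
    Integrable (fun ω => ‖∑ i, Z i ω • W i ω‖ ^ 2) P ∧
      ∫ ω, ‖∑ i, Z i ω • W i ω‖ ^ 2 ∂P = ∑ i, ∫ ω, ‖W i ω‖ ^ 2 ∂P := by
  have hWj : ∀ i j, Measurable fun ω => W i ω j := fun i j => by fun_prop
  have hW2j : ∀ i j, MemLp (fun ω => W i ω j) 2 P := fun i j => by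
    refine (memLp_two_iff_integrable_sq (hWj i j).aestronglyMeasurable).2
      ((hW2 i).mono' (by fun_prop) (Eventually.of_forall fun ω => ?_))
    rw [Real.norm_of_nonneg (sq_nonneg _), EuclideanSpace.real_norm_sq_eq]
    exact Finset.single_le_sum (f := fun j => W i ω j ^ 2) (fun _ _ => sq_nonneg _)
      (Finset.mem_univ j)
  have hmain := fun j => integral_sq_sum_mul_of_indepFun hZ (fun i => hWj i j) hind
    (hZW.comp (φ := fun z : ι → ℝ => z)
      (ψ := fun (v : ι → EuclideanSpace ℝ (Fin q)) i => v i j) measurable_id (by fun_prop)) hZ2 h0 h1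
    (fun i => hW2j i j)
  have hexp : ∀ ω, ‖∑ i, Z i ω • W i ω‖ ^ 2 = ∑ j, (∑ i, Z i ω * W i ω j) ^ 2 := by
    intro ω
    rw [EuclideanSpace.real_norm_sq_eq]
    simp
  simp_rw [hexp, EuclideanSpace.real_norm_sq_eq]
  refine ⟨integrable_finsetSum _ fun j _ => (hmain j).1, ?_⟩
  rw [integral_finsetSum _ fun j _ => (hmain j).1]
  simp_rw [fun j => (hmain j).2]
  rw [Finset.sum_comm]
  refine Finset.sum_congr rfl fun i _ => ?_
  rw [integral_finsetSum _ fun j _ => (hW2j i j).integrable_sq]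

variable [IsProbabilityMeasure P]

/-- Beyond the truncation level, `x² = |x|^(2-p) |x|^p` and the first factor is at most `L^(2-p)`
because `2 - p ≤ 0`. -/
theorem sq_sub_min_le {p : ℝ} (hp2 : 2 ≤ p) {L : ℝ} (hL : 0 < L) (x : ℝ) :
    x ^ 2 - min (x ^ 2) (L ^ 2) ≤ L ^ (2 - p) * |x| ^ p := by
  rcases le_or_gt |x| L with h | h
  · have : x ^ 2 ≤ L ^ 2 := by rw [← sq_abs]; gcongr
    rw [min_eq_left this, sub_self]
    positivity
  · have hx : 0 < |x| := hL.trans h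
    have h2 : L ^ (2 - p) * |x| ^ p ≥ |x| ^ (2 - p) * |x| ^ p :=
      mul_le_mul_of_nonneg_right (Real.rpow_le_rpow_of_nonpos hL h.le (by linarith)) (by positivity)
    rw [← Real.rpow_add hx, sub_add_cancel, Real.rpow_two, sq_abs] at h2
    have : 0 ≤ min (x ^ 2) (L ^ 2) := by positivity
    linarith

/-- A weak law of large numbers for the squares of a triangular array of standardized independent
variables with a bounded moment of order greater than two. -/
theorem isLittleOp_mean_sq_sub_one {Z : (n : ℕ) → Fin n → Ω → ℝ}
    (hZ : ∀ n i, Measurable (Z n i)) (hind : ∀ n, iIndepFun (Z n) P)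
    (h1 : ∀ n i, ∫ ω, Z n i ω ^ 2 ∂P = 1) {p M : ℝ} (hp2 : 2 < p)
    (hZp : ∀ n i, Integrable (fun ω => |Z n i ω| ^ p) P)
    (hZM : ∀ n i, ∫ ω, |Z n i ω| ^ p ∂P ≤ M) :
    IsLittleOp P fun n ω => (n : ℝ)⁻¹ * ∑ i, Z n i ω ^ 2 - 1 := by
  -- The truncation level must tend to infinity, so that `L^(2-p) → 0` removes the tails, with `L² /
  -- n → 0`, so that the variance of the truncated mean vanishes. The shift `n + 1` keeps it
  -- positive at `n = 0`.
  set L : ℕ → ℝ := fun n => ((n : ℝ) + 1) ^ (1 / 4 : ℝ) with hL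
  have hL0 : ∀ n, 0 < L n := fun n => by positivity
  have hsq : ∀ n i, Integrable (fun ω => Z n i ω ^ 2) P := fun n i =>
    integrable_sq_of_integrable_abs_rpow (hZ n i) hp2.le (hZp n i)
  set Y : (n : ℕ) → Fin n → Ω → ℝ := fun n i ω => min (Z n i ω ^ 2) (L n ^ 2) with hY
  have hYm : ∀ n i, Measurable (Y n i) := fun n i => by fun_prop
  have hY0 : ∀ n i ω, 0 ≤ Y n i ω := fun n i ω => by positivity
  have hYb : ∀ n i ω, |Y n i ω| ≤ L n ^ 2 := fun n i ω => by
    rw [abs_of_nonneg (hY0 n i ω)]; exact min_le_right _ _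
  have hYL : ∀ n i, MemLp (Y n i) 2 P := fun n i =>
    MemLp.of_bound (hYm n i).aestronglyMeasurable (L n ^ 2) (Eventually.of_forall (hYb n i))
  have hYi : ∀ n i, Integrable (Y n i) P := fun n i => (hYL n i).integrable (by norm_num)
  -- `A` is the discarded tail and `B` the centred truncated mean. As `E Z² = 1`, the target equals
  -- `A + B - E A` for `n ≥ 1`.
  set A : ℕ → Ω → ℝ := fun n ω => (n : ℝ)⁻¹ * ∑ i, (Z n i ω ^ 2 - Y n i ω) with hA
  set B : ℕ → Ω → ℝ := fun n ω => (n : ℝ)⁻¹ * ∑ i, Y n i ω - ∫ ω', (n : ℝ)⁻¹ * ∑ i, Y n i ω' ∂P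
    with hB
  have hA0 : ∀ n ω, 0 ≤ A n ω := fun n ω => mul_nonneg (by positivity)
    (Finset.sum_nonneg fun i _ => sub_nonneg.2 (min_le_left _ _))
  have hAi : ∀ n, Integrable (A n) P := fun n =>
    (integrable_finsetSum _ fun i _ => (hsq n i).sub (hYi n i)).const_mul _
  have hM0 : ∀ n, ∫ ω, A n ω ∂P ≤ L n ^ (2 - p) * |M| := by
    intro n
    have hterm : ∀ i, ∫ ω, (Z n i ω ^ 2 - Y n i ω) ∂P ≤ L n ^ (2 - p) * |M| := by
      intro i
      calc _ ≤ ∫ ω, L n ^ (2 - p) * |Z n i ω| ^ p ∂P :=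
            integral_mono ((hsq n i).sub (hYi n i)) ((hZp n i).const_mul _)
              fun ω => sq_sub_min_le hp2.le (hL0 n) _
        _ = L n ^ (2 - p) * ∫ ω, |Z n i ω| ^ p ∂P := integral_const_mul _ _
        _ ≤ _ := by
            gcongr
            exact (hZM n i).trans (le_abs_self M)
    have hsum := integral_finsetSum Finset.univ fun i _ => (hsq n i).sub (hYi n i)
    simp only [Pi.sub_apply] at hsum
    rw [hA, integral_const_mul, hsum]
    have hs := Finset.sum_le_card_nsmul Finset.univ _ _ (fun i _ => hterm i)
    simp only [Finset.card_univ, Fintype.card_fin, nsmul_eq_mul] at hs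
    have hn : (n : ℝ)⁻¹ * n ≤ 1 := inv_mul_le_one
    calc _ ≤ (n : ℝ)⁻¹ * (n * (L n ^ (2 - p) * |M|)) := by gcongr
      _ = ((n : ℝ)⁻¹ * n) * (L n ^ (2 - p) * |M|) := by ring
      _ ≤ 1 * (L n ^ (2 - p) * |M|) := by gcongr
      _ = _ := one_mul _
  have hn1 : Tendsto (fun n : ℕ => (n : ℝ) + 1) atTop atTop :=
    tendsto_natCast_atTop_atTop.atTop_add tendsto_const_nhds
  have hLlim : Tendsto (fun n => L n ^ (2 - p)) atTop (𝓝 0) := by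
    have := (tendsto_rpow_neg_atTop (show 0 < (p - 2) / 4 by linarith)).comp hn1
    refine this.congr fun n => ?_
    simp only [Function.comp_apply, hL]
    rw [← Real.rpow_mul (by positivity)]
    congr 1
    ring
  have hEA : Tendsto (fun n => ∫ ω, A n ω ∂P) atTop (𝓝 0) := by
    refine squeeze_zero (fun n => integral_nonneg (hA0 n)) hM0 ?_
    simpa using hLlim.mul_const |M|
  have hAo : IsLittleOp P A := by
    refine isLittleOp_of_tendsto_integral_norm hAi (hEA.congr fun n => ?_)
    exact integral_congr_ae (Eventually.of_forall fun ω => (Real.norm_of_nonneg (hA0 n ω)).symm)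
  have hEAo : IsLittleOp P fun n (_ : Ω) => -∫ ω, A n ω ∂P := by
    refine isLittleOp_of_tendsto_integral_norm (fun n => integrable_const _) ?_
    simpa using hEA.abs
  have hmean : ∀ n : ℕ, MemLp (fun ω => (n : ℝ)⁻¹ * ∑ i, Y n i ω) 2 P := fun n =>
    (memLp_finsetSum _ fun i _ => hYL n i).const_mul _
  have hBvar : ∀ n, ∫ ω, B n ω ^ 2 ∂P ≤ (n : ℝ)⁻¹ * L n ^ 2 := by
    intro n
    have hind' : iIndepFun (Y n) P := (hind n).comp (fun _ x => min (x ^ 2) (L n ^ 2))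
      (fun _ => by fun_prop)
    -- `Y² ≤ L² Z²` and `E Z² = 1`, so no fourth moment is needed.
    have hv : ∀ i, Var[Y n i; P] ≤ L n ^ 2 := fun i => by
      refine (variance_le_expectation_sq (hYm n i).aestronglyMeasurable).trans ?_
      calc _ ≤ ∫ ω, L n ^ 2 * Z n i ω ^ 2 ∂P := by
            refine integral_mono (hYL n i).integrable_sq ((hsq n i).const_mul _) fun ω => ?_
            simp only [Pi.pow_apply]
            rw [sq (Y n i ω)]
            exact mul_le_mul (min_le_right _ _) (min_le_left _ _) (hY0 n i ω) (by positivity)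
        _ = _ := by rw [integral_const_mul, h1, mul_one]
    have hvar := IndepFun.variance_sum (s := Finset.univ) (fun i _ => hYL n i)
      (fun i _ j _ hij => hind'.indepFun hij)
    have : ∫ ω, B n ω ^ 2 ∂P = (n : ℝ)⁻¹ ^ 2 * ∑ i, Var[Y n i; P] := by
      rw [← hvar, ← variance_const_mul, variance_eq_integral (by fun_prop)]
      simp [hB, Finset.sum_apply]
    rw [this]
    have hs := Finset.sum_le_card_nsmul Finset.univ _ _ (fun i _ => hv i)
    simp only [Finset.card_univ, Fintype.card_fin, nsmul_eq_mul] at hs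
    have hn : (n : ℝ)⁻¹ * n ≤ 1 := inv_mul_le_one
    calc _ ≤ (n : ℝ)⁻¹ ^ 2 * (n * L n ^ 2) := by gcongr
      _ = ((n : ℝ)⁻¹ * n) * ((n : ℝ)⁻¹ * L n ^ 2) := by ring
      _ ≤ 1 * ((n : ℝ)⁻¹ * L n ^ 2) := by gcongr
      _ = _ := one_mul _
  have hBo : IsLittleOp P B := by
    refine isLittleOp_of_tendsto_integral_sq
      (fun n => MemLp.integrable_sq (f := B n) ((hmean n).sub (memLp_const _))) ?_
    have hlim : Tendsto (fun n : ℕ => 2 * ((n : ℝ) + 1) ^ (-(1 / 2) : ℝ)) atTop (𝓝 0) := by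
      simpa using ((tendsto_rpow_neg_atTop (show (0 : ℝ) < 1 / 2 by norm_num)).comp hn1).const_mul 2
    refine squeeze_zero' (Eventually.of_forall fun n => integral_nonneg fun ω => sq_nonneg _) ?_ hlim
    filter_upwards [eventually_ge_atTop 1] with n hn
    refine (hBvar n).trans ?_
    have hn' : (1 : ℝ) ≤ n := by exact_mod_cast hn
    have hL2 : L n ^ 2 = ((n : ℝ) + 1) * ((n : ℝ) + 1) ^ (-(1 / 2) : ℝ) := by
      simp only [hL]
      rw [← Real.rpow_natCast, ← Real.rpow_mul (by positivity)]
      nth_rewrite 2 [← Real.rpow_one ((n : ℝ) + 1)]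
      rw [← Real.rpow_add (by positivity)]
      norm_num
    rw [hL2, ← mul_assoc]
    gcongr
    rw [inv_mul_le_iff₀ (by positivity)]
    linarith
  refine ((hAo.add hBo).add hEAo).of_norm_le ?_
  filter_upwards [eventually_ge_atTop 1] with n hn
  have hn' : (n : ℝ) ≠ 0 := by positivity
  refine Eventually.of_forall fun ω => le_of_eq ?_
  congr 1
  have hEA' : ∫ ω, A n ω ∂P = 1 - ∫ ω', (n : ℝ)⁻¹ * ∑ i, Y n i ω' ∂P := by
    simp only [hA, Finset.sum_sub_distrib, mul_sub]
    rw [integral_sub ((integrable_finsetSum _ fun i _ => hsq n i).const_mul _)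
      ((integrable_finsetSum _ fun i _ => hYi n i).const_mul _), integral_const_mul,
      integral_finsetSum _ fun i _ => hsq n i]
    simp [h1, hn']
  rw [hEA']
  simp only [hA, hB, Finset.sum_sub_distrib]
  ring

end Moments

/-! ### Deterministic analysis of the normal equations. -/

section LeastSquares

open scoped MatrixOrder in
theorem mul_norm_sq_le_of_le_lambdaMin {n q : ℕ} {w : Fin n → EuclideanSpace ℝ (Fin q)} {c : ℝ}
    (hc : c ≤ lambdaMin (controlGram w)) (v : EuclideanSpace ℝ (Fin q)) :
    c * ‖v‖ ^ 2 ≤ (n : ℝ)⁻¹ * ∑ i, inner ℝ (w i) v ^ 2 := by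
  have hH : (controlGram w).IsHermitian := by
    ext i j
    simp [controlGram, Matrix.sum_apply, Matrix.vecMulVec_apply, mul_comm]
  -- Needed for `sInf` to be a genuine lower bound of the spectrum.
  have hbdd : BddBelow (spectrum ℝ (controlGram w)) := by
    rw [hH.spectrum_real_eq_range_eigenvalues]
    exact (Set.finite_range _).bddBelow
  have hle : algebraMap ℝ (Matrix (Fin q) (Fin q) ℝ) c ≤ controlGram w :=
    (algebraMap_le_iff_le_spectrum hH).2 fun x hx => hc.trans (csInf_le hbdd hx)
  have hpos := (Matrix.le_iff.1 hle).dotProduct_mulVec_nonneg v.ofLp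
  rw [Matrix.sub_mulVec, dotProduct_sub, Algebra.algebraMap_eq_smul_one, Matrix.smul_mulVec,
    Matrix.one_mulVec, dotProduct_smul] at hpos
  have hG : star v.ofLp ⬝ᵥ controlGram w *ᵥ v.ofLp = (n : ℝ)⁻¹ * ∑ i, inner ℝ (w i) v ^ 2 := by
    rw [controlGram, Matrix.smul_mulVec, Matrix.sum_mulVec, dotProduct_smul, dotProduct_sum,
      smul_eq_mul]
    congr 1
    refine Finset.sum_congr rfl fun i _ => ?_
    rw [Matrix.vecMulVec_mulVec]
    simp [dotProduct, PiLp.inner_apply, sq, mul_comm, mul_left_comm, Finset.mul_sum]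
    exact Finset.sum_congr rfl fun j _ => Finset.sum_congr rfl fun k _ => by ring
  have hv : star v.ofLp ⬝ᵥ v.ofLp = ‖v‖ ^ 2 := by
    rw [EuclideanSpace.real_norm_sq_eq]
    simp [dotProduct, sq]
  rw [hG, hv, smul_eq_mul] at hpos
  linarith

/-- Solutions of the normal equations with a centred regressor `z` and controls `w` whose Gram
matrix is bounded below. -/
theorem normal_equations_bound {n : ℕ} {E : Type*} [NormedAddCommGroup E] [InnerProductSpace ℝ E]
    (hn : 1 ≤ n) {z η : Fin n → ℝ} {w : Fin n → E} {b c : ℝ} {f : E} (hc : 0 < c)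
    (hquad : c * ‖f‖ ^ 2 ≤ (n : ℝ)⁻¹ * ∑ i, inner ℝ (w i) f ^ 2)
    (hz : ∑ i, (z i * b + inner ℝ (w i) f - η i) * z i = 0)
    (hw : ∑ i, (z i * b + inner ℝ (w i) f - η i) • w i = 0) :
    ‖f‖ ≤ (‖(n : ℝ)⁻¹ • ∑ i, η i • w i‖
        + ‖(√(n : ℝ))⁻¹ • ∑ i, z i • w i‖ * |√(n : ℝ) * b| / n) / c ∧
      |((n : ℝ)⁻¹ * ∑ i, z i ^ 2) * (√(n : ℝ) * b) - (√(n : ℝ))⁻¹ * ∑ i, z i * η i|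
        ≤ ‖(√(n : ℝ))⁻¹ • ∑ i, z i • w i‖ * ((‖(n : ℝ)⁻¹ • ∑ i, η i • w i‖
        + ‖(√(n : ℝ))⁻¹ • ∑ i, z i • w i‖ * |√(n : ℝ) * b| / n) / c) := by
  set a : E := (√(n : ℝ))⁻¹ • ∑ i, z i • w i with ha
  set g : E := (n : ℝ)⁻¹ • ∑ i, η i • w i with hg
  have hn0 : (0 : ℝ) < n := by exact_mod_cast hn
  have hs0 : 0 < √(n : ℝ) := Real.sqrt_pos.2 hn0
  have hss : √(n : ℝ) * √(n : ℝ) = n := Real.mul_self_sqrt hn0.le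
  have haf : inner ℝ a f = (√(n : ℝ))⁻¹ * ∑ i, z i * inner ℝ (w i) f := by
    simp [ha, inner_smul_left, sum_inner]
  have hgf : inner ℝ g f = (n : ℝ)⁻¹ * ∑ i, η i * inner ℝ (w i) f := by
    simp [hg, inner_smul_left, sum_inner]
  -- The vector equation is paired with `f` itself, which produces the Gram quadratic form.
  have hwf : b * ∑ i, z i * inner ℝ (w i) f + ∑ i, inner ℝ (w i) f ^ 2
      - ∑ i, η i * inner ℝ (w i) f = 0 := by
    have := congrArg (fun x => inner ℝ x f) hw
    simp only [sum_inner, inner_smul_left, inner_zero_left, RCLike.conj_to_real] at this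
    rw [← this, Finset.mul_sum, ← Finset.sum_add_distrib, ← Finset.sum_sub_distrib]
    exact Finset.sum_congr rfl fun i _ => by ring
  have hzf : b * ∑ i, z i ^ 2 + ∑ i, z i * inner ℝ (w i) f - ∑ i, z i * η i = 0 := by
    rw [← hz, Finset.mul_sum, ← Finset.sum_add_distrib, ← Finset.sum_sub_distrib]
    exact Finset.sum_congr rfl fun i _ => by ring
  have hf : ‖f‖ ≤ (‖g‖ + ‖a‖ * |√(n : ℝ) * b| / n) / c := by
    rw [le_div_iff₀ hc]
    have hQ : (n : ℝ)⁻¹ * ∑ i, inner ℝ (w i) f ^ 2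
        = inner ℝ g f - (√(n : ℝ) * b) / n * inner ℝ a f := by
      rw [haf, hgf]
      field_simp
      linarith
    have h1 : inner ℝ g f ≤ ‖g‖ * ‖f‖ := real_inner_le_norm g f
    have h2 : |(√(n : ℝ) * b) / n * inner ℝ a f| ≤ |√(n : ℝ) * b| / n * (‖a‖ * ‖f‖) := by
      rw [abs_mul, abs_div, abs_of_pos hn0]
      gcongr
      exact abs_real_inner_le_norm a f
    have h3 := neg_abs_le ((√(n : ℝ) * b) / n * inner ℝ a f)
    have h4 : c * ‖f‖ ^ 2 ≤ (‖g‖ + ‖a‖ * |√(n : ℝ) * b| / n) * ‖f‖ := by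
      calc _ ≤ ‖g‖ * ‖f‖ + |√(n : ℝ) * b| / n * (‖a‖ * ‖f‖) := by linarith
        _ = _ := by ring
    rcases (norm_nonneg f).eq_or_lt with h0 | h0
    · rw [← h0, zero_mul]; positivity
    · exact le_of_mul_le_mul_right (by linarith) h0
  refine ⟨hf, ?_⟩
  have hsu : ((n : ℝ)⁻¹ * ∑ i, z i ^ 2) * (√(n : ℝ) * b) - (√(n : ℝ))⁻¹ * ∑ i, z i * η i
      = -inner ℝ a f := by
    have hinv : (n : ℝ)⁻¹ * √(n : ℝ) = (√(n : ℝ))⁻¹ := by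
      field_simp
      rw [sq, hss]
    rw [haf]
    linear_combination (√(n : ℝ))⁻¹ * hzf + (∑ i, z i ^ 2) * b * hinv
  rw [hsu, abs_neg]
  refine (abs_real_inner_le_norm a f).trans ?_
  gcongr

/-- The normal equations of the regression on `(d, w)`, expressed through the standardized
regressor; the shift of `d` is absorbed by the constant first control. -/
theorem exists_normal_equations {n p : ℕ} {d z η : Fin n → ℝ}
    {w : Fin n → EuclideanSpace ℝ (Fin (p + 1))} {m σ c₀ : ℝ} (hσ : σ ≠ 0) (hc₀ : c₀ ≠ 0)
    (hd : ∀ i, d i = m + σ * z i) (hw : ∀ i, w i 0 = c₀) {θ : Unit ⊕ Fin (p + 1) → ℝ}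
    (hθ : ((designMatrix d w)ᵀ * designMatrix d w) *ᵥ θ = (designMatrix d w)ᵀ *ᵥ η) :
    ∃ f : EuclideanSpace ℝ (Fin (p + 1)),
      (∀ j, f j = θ (Sum.inr j) + if j = 0 then m * θ (Sum.inl ()) / c₀ else 0) ∧
      ∑ i, (z i * (σ * θ (Sum.inl ())) + inner ℝ (w i) f - η i) * z i = 0 ∧
      ∑ i, (z i * (σ * θ (Sum.inl ())) + inner ℝ (w i) f - η i) • w i = 0 := by
  -- As `d = m + σ z` and `m = (m / c₀) c₀`, the mean of `d` is carried by the intercept coordinate.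
  let f : EuclideanSpace ℝ (Fin (p + 1)) :=
    WithLp.toLp 2 fun j => θ (Sum.inr j) + if j = 0 then m * θ (Sum.inl ()) / c₀ else 0
  have hr : ∀ i, z i * (σ * θ (Sum.inl ())) + inner ℝ (w i) f - η i
      = (designMatrix d w *ᵥ θ) i - η i := by
    intro i
    have : inner ℝ (w i) f = (∑ j, w i j * θ (Sum.inr j)) + m * θ (Sum.inl ()) := by
      simp only [PiLp.inner_apply, f, RCLike.inner_apply, conj_trivial, add_mul,
        Finset.sum_add_distrib]
      congr 1
      · exact Finset.sum_congr rfl fun j _ => mul_comm _ _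
      · simp [hw, hc₀]
    rw [this]
    simp [designMatrix, Matrix.mulVec, dotProduct, Matrix.fromCols_apply_inl,
      Matrix.fromCols_apply_inr, Matrix.replicateCol_apply, hd]
    ring
  have h0 : (designMatrix d w)ᵀ *ᵥ (designMatrix d w *ᵥ θ - η) = 0 := by
    rw [Matrix.mulVec_sub, Matrix.mulVec_mulVec, hθ, sub_self]
  set r := designMatrix d w *ᵥ θ - η with hrdef
  have hr' : ∀ i, z i * (σ * θ (Sum.inl ())) + inner ℝ (w i) f - η i = r i := hr
  have hinl : ∑ i, d i * r i = 0 := by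
    have := congrFun h0 (Sum.inl ())
    simpa [designMatrix, Matrix.mulVec, dotProduct] using this
  have hinr : ∀ j, ∑ i, w i j * r i = 0 := fun j => by
    have := congrFun h0 (Sum.inr j)
    simpa [designMatrix, Matrix.mulVec, dotProduct] using this
  -- Residuals sum to zero because they are orthogonal to a nonzero constant column; this lets `d`
  -- be replaced by `z` below.
  have hsum : ∑ i, r i = 0 := by
    have := hinr 0
    simp_rw [hw, ← Finset.mul_sum] at this
    exact (mul_eq_zero.1 this).resolve_left hc₀
  refine ⟨f, fun j => rfl, ?_, ?_⟩
  · simp_rw [hr']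
    simp_rw [hd, add_mul, Finset.sum_add_distrib, ← Finset.mul_sum, hsum, mul_zero, zero_add,
      mul_assoc, ← Finset.mul_sum] at hinl
    have := (mul_eq_zero.1 hinl).resolve_left hσ
    rw [← this]
    exact Finset.sum_congr rfl fun i _ => mul_comm _ _
  · simp_rw [hr']
    ext j
    simpa [mul_comm] using hinr j

/-- The bound on normal equations is used twice. With zero errors, `hs` forces the only solution to
be zero, so the design is nonsingular; with the errors `ε`, it is the estimate itself. -/
theorem abs_betaHat_sub_le {n p : ℕ} (hn : 1 ≤ n) {d z y ε : Fin n → ℝ}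
    {w : Fin n → EuclideanSpace ℝ (Fin (p + 1))} {m σ c₀ c β : ℝ}
    {γ : EuclideanSpace ℝ (Fin (p + 1))} (hσ : σ ≠ 0) (hc₀ : c₀ ≠ 0) (hc : 0 < c)
    (hd : ∀ i, d i = m + σ * z i) (hw : ∀ i, w i 0 = c₀)
    (hy : ∀ i, y i = d i * β + (∑ j, w i j * γ j) + ε i)
    (hmin : c ≤ lambdaMin (controlGram w))
    (hs : ‖(√(n : ℝ))⁻¹ • ∑ i, z i • w i‖ ^ 2 / (c * n) < (n : ℝ)⁻¹ * ∑ i, z i ^ 2) :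
    |((n : ℝ)⁻¹ * ∑ i, z i ^ 2) * (√(n : ℝ) * (σ * (betaHat d w y - β)))
        - (√(n : ℝ))⁻¹ * ∑ i, z i * ε i|
      ≤ ‖(√(n : ℝ))⁻¹ • ∑ i, z i • w i‖ * ((‖(n : ℝ)⁻¹ • ∑ i, ε i • w i‖
        + ‖(√(n : ℝ))⁻¹ • ∑ i, z i • w i‖ * |√(n : ℝ) * (σ * (betaHat d w y - β))| / n) / c) := by
  have hn0 : (0 : ℝ) < n := by exact_mod_cast hn
  have hsq : 0 < √(n : ℝ) := Real.sqrt_pos.2 hn0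
  have hinj : Function.Injective ((designMatrix d w)ᵀ * designMatrix d w).mulVec := by
    rw [← Matrix.coe_mulVecLin]
    refine (injective_iff_map_eq_zero _).2 fun θ hθ => ?_
    rw [Matrix.mulVecLin_apply] at hθ
    obtain ⟨f, hf, hA, hB⟩ := exists_normal_equations (η := 0) hσ hc₀ hd hw
      (θ := θ) (by rw [hθ, Matrix.mulVec_zero])
    obtain ⟨h1, h2⟩ := normal_equations_bound hn hc (mul_norm_sq_le_of_le_lambdaMin hmin f) hA hB
    simp only [Pi.zero_apply, zero_smul, Finset.sum_const_zero, smul_zero, norm_zero, zero_add,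
      mul_zero, sub_zero] at h1 h2
    set t := √(n : ℝ) * (σ * θ (Sum.inl ())) with ht
    have ht0 : t = 0 := by
      by_contra hne
      have htp : 0 < |t| := abs_pos.2 hne
      rw [abs_mul] at h2
      have h3 := mul_lt_mul_of_pos_right hs htp
      have h4 := mul_le_mul_of_nonneg_right (le_abs_self ((n : ℝ)⁻¹ * ∑ i, z i ^ 2)) htp.le
      have h5 : ‖(√(n : ℝ))⁻¹ • ∑ i, z i • w i‖ ^ 2 / (c * n) * |t|
          = ‖(√(n : ℝ))⁻¹ • ∑ i, z i • w i‖ * (‖(√(n : ℝ))⁻¹ • ∑ i, z i • w i‖ * |t| / n / c) := by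
        field_simp
      linarith
    have hθ0 : θ (Sum.inl ()) = 0 := by
      simpa [ht, hsq.ne', hσ] using ht0
    rw [ht0, abs_zero, mul_zero, zero_div, zero_div, norm_le_zero_iff] at h1
    ext k
    rcases k with k | j
    · exact hθ0
    · have := hf j
      simp only [h1, hθ0, mul_zero, zero_div, ite_self, add_zero, PiLp.zero_apply] at this
      exact this.symm
  have hunit : IsUnit ((designMatrix d w)ᵀ * designMatrix d w) :=
    Matrix.mulVec_injective_iff_isUnit.1 hinj
  let θ₀ : Unit ⊕ Fin (p + 1) → ℝ := Sum.elim (fun _ => β) fun j => γ j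
  have hy' : y = designMatrix d w *ᵥ θ₀ + ε := by
    ext i
    rw [hy]
    simp [designMatrix, Matrix.mulVec, dotProduct, θ₀]
  have hols : ((designMatrix d w)ᵀ * designMatrix d w) *ᵥ (olsCoef (designMatrix d w) y - θ₀)
      = (designMatrix d w)ᵀ *ᵥ ε := by
    rw [Matrix.mulVec_sub, olsCoef, Matrix.mulVec_mulVec,
      Matrix.mul_nonsing_inv _ ((Matrix.isUnit_iff_isUnit_det _).1 hunit), Matrix.one_mulVec, hy',
      Matrix.mulVec_add, Matrix.mulVec_mulVec, add_sub_cancel_left]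
  obtain ⟨f, -, hA, hB⟩ := exists_normal_equations hσ hc₀ hd hw hols
  exact (normal_equations_bound hn hc (mul_norm_sq_le_of_le_lambdaMin hmin f) hA hB).2

/-- Cramer's rule: determinant and adjugate are polynomial in the data, and inversion with `0⁻¹ = 0`
is measurable, singular designs included. -/
theorem measurable_betaHat {Ω : Type*} [MeasurableSpace Ω] {n q : ℕ} {d y : Fin n → Ω → ℝ}
    {w : Fin n → Ω → EuclideanSpace ℝ (Fin q)} (hd : ∀ i, Measurable (d i))
    (hw : ∀ i, Measurable (w i)) (hy : ∀ i, Measurable (y i)) :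
    Measurable fun ω => betaHat (fun i => d i ω) (fun i => w i ω) (fun i => y i ω) := by
  have hX : ∀ i k, Measurable fun ω => designMatrix (fun i => d i ω) (fun i => w i ω) i k := by
    intro i k
    rcases k with k | j
    · simpa [designMatrix] using hd i
    · simp only [designMatrix, Matrix.fromCols_apply_inr, Matrix.of_apply]
      fun_prop
  have hdet : ∀ {A : Ω → Matrix (Unit ⊕ Fin q) (Unit ⊕ Fin q) ℝ},
      (∀ k l, Measurable fun ω => A ω k l) → Measurable fun ω => (A ω).det := by
    intro A hA
    simp only [Matrix.det_apply']
    fun_prop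
  have hG : ∀ k l, Measurable fun ω => ((designMatrix (fun i => d i ω) (fun i => w i ω))ᵀ
      * designMatrix (fun i => d i ω) (fun i => w i ω)) k l := by
    intro k l
    simp only [Matrix.mul_apply, Matrix.transpose_apply]
    fun_prop
  have hadj : ∀ k l, Measurable fun ω => ((designMatrix (fun i => d i ω) (fun i => w i ω))ᵀ
      * designMatrix (fun i => d i ω) (fun i => w i ω)).adjugate k l := by
    intro k l
    simp only [Matrix.adjugate_apply]
    refine hdet fun k' l' => ?_
    simp only [Matrix.updateRow_apply]
    split_ifs
    · exact measurable_const
    · exact hG k' l'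
  simp only [betaHat, olsCoef, Matrix.inv_def, Ring.inverse_eq_inv', Matrix.mulVec, dotProduct,
    Matrix.smul_apply, smul_eq_mul, Matrix.transpose_apply]
  refine Finset.measurable_sum _ fun k _ => Measurable.mul (Measurable.mul ?_ (hadj _ k)) ?_
  · exact (hdet hG).inv
  · fun_prop

end LeastSquares

/-! ### Uniform moment bounds after standardization. -/

section Standardization

variable {Ω : Type*} [MeasurableSpace Ω] {P : Measure Ω}

theorem sigmaEps_sq {n : ℕ} {ε : Fin n → Ω → ℝ} (hε : ∀ i, Measurable (ε i))
    (h0 : ∀ i, ∫ ω, ε i ω ∂P = 0) :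
    sigmaEps P ε ^ 2 = (n : ℝ)⁻¹ * ∑ i, ∫ ω, ε i ω ^ 2 ∂P := by
  rw [sigmaEps, Real.sq_sqrt (mul_nonneg (by positivity)
    (Finset.sum_nonneg fun i _ => variance_nonneg _ _))]
  congr 1
  refine Finset.sum_congr rfl fun i _ => ?_
  rw [variance_eq_integral (hε i).aemeasurable, h0 i]
  simp

theorem inv_le_one_add_of_inv_le_sq {K σ : ℝ} (hK : 0 < K) (hσ : 0 ≤ σ) (h : K⁻¹ ≤ σ ^ 2) :
    0 < σ ∧ σ⁻¹ ≤ 1 + K := by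
  have hσ0 : 0 < σ := by
    rcases hσ.eq_or_lt with h0 | h0
    · rw [← h0] at h
      have := inv_pos.2 hK
      norm_num at h
      linarith
    · exact h0
  refine ⟨hσ0, ?_⟩
  have h1 : (σ⁻¹) ^ 2 ≤ K := by
    rw [inv_pow]
    exact inv_le_of_inv_le₀ hK h
  nlinarith [inv_pos.2 hσ0]

/-- The normalized errors form an asymptotically negligible array of weights whose sum of squares
converges to one. -/
theorem normalized_errors {ε : (n : ℕ) → Fin n → Ω → ℝ} {K p : ℝ}
    (hε_meas : ∀ n i, Measurable (ε n i)) (hε_mean : ∀ n i, ∫ ω, ε n i ω ∂P = 0) (hK : 0 < K)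
    (hp2 : 2 < p)
    (hε_lln : IsLittleOp P fun (n : ℕ) ω =>
      (n : ℝ)⁻¹ * ∑ i, ε n i ω ^ 2 - (n : ℝ)⁻¹ * ∑ i, ∫ ω', ε n i ω' ^ 2 ∂P)
    (hεp : ∀ n i, Integrable (fun ω => |ε n i ω| ^ p) P)
    (hεK : ∀ n i, ∫ ω, |ε n i ω| ^ p ∂P ≤ 1 + K)
    (hε_lower : ∀ n : ℕ, 1 ≤ n → K⁻¹ ≤ (n : ℝ)⁻¹ * ∑ i, ∫ ω, ε n i ω ^ 2 ∂P) :
    (∀ (n : ℕ) i, Integrable (fun ω => |(√(n : ℝ))⁻¹ * ε n i ω / sigmaEps P (ε n)| ^ p) P) ∧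
    Tendsto (fun n : ℕ => ∑ i, ∫ ω, |(√(n : ℝ))⁻¹ * ε n i ω / sigmaEps P (ε n)| ^ p ∂P) atTop
      (𝓝 0) ∧
    (IsLittleOp P fun (n : ℕ) ω => ∑ i, ((√(n : ℝ))⁻¹ * ε n i ω / sigmaEps P (ε n)) ^ 2 - 1) ∧
    (∀ n : ℕ, 1 ≤ n → ∑ i, ∫ ω, ((√(n : ℝ))⁻¹ * ε n i ω / sigmaEps P (ε n)) ^ 2 ∂P = 1) := by
  have hσ : ∀ n : ℕ, 1 ≤ n → 0 < sigmaEps P (ε n) ∧ (sigmaEps P (ε n))⁻¹ ≤ 1 + K := fun n hn =>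
    inv_le_one_add_of_inv_le_sq hK (Real.sqrt_nonneg _)
      (by rw [sigmaEps_sq (hε_meas n) (hε_mean n)]; exact hε_lower n hn)
  have hpow : ∀ (n : ℕ) i ω, |(√(n : ℝ))⁻¹ * ε n i ω / sigmaEps P (ε n)| ^ p
      = ((√(n : ℝ))⁻¹ * (sigmaEps P (ε n))⁻¹) ^ p * |ε n i ω| ^ p := by
    intro n i ω
    have hσ0 : 0 ≤ sigmaEps P (ε n) := Real.sqrt_nonneg _
    rw [← Real.mul_rpow (by positivity) (abs_nonneg _), abs_div, abs_mul, abs_of_nonneg hσ0,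
      abs_of_nonneg (by positivity : 0 ≤ (√(n : ℝ))⁻¹)]
    congr 1
    ring
  have hsq : ∀ (n : ℕ) i ω, ((√(n : ℝ))⁻¹ * ε n i ω / sigmaEps P (ε n)) ^ 2
      = (sigmaEps P (ε n) ^ 2)⁻¹ * ((n : ℝ)⁻¹ * ε n i ω ^ 2) := by
    intro n i ω
    rw [div_pow, mul_pow, inv_pow, Real.sq_sqrt (Nat.cast_nonneg n)]
    ring
  refine ⟨fun n i => ?_, ?_, ?_, fun n hn => ?_⟩
  · simp_rw [hpow]
    exact (hεp n i).const_mul _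
  -- There are `n = √n ^ 2` summands, each of order `√n ^ (-p)`.
  · have hlim : Tendsto (fun n : ℕ => (√(n : ℝ)) ^ (-(p - 2)) * ((1 + K) ^ p * (1 + K))) atTop
        (𝓝 0) := by
      simpa using ((tendsto_rpow_neg_atTop (show 0 < p - 2 by linarith)).comp
        (Real.tendsto_sqrt_atTop.comp tendsto_natCast_atTop_atTop)).mul_const
          ((1 + K) ^ p * (1 + K))
    refine squeeze_zero' (Eventually.of_forall fun n => Finset.sum_nonneg fun i _ =>
      integral_nonneg fun ω => by positivity) ?_ hlim
    filter_upwards [eventually_ge_atTop 1] with n hn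
    have hs0 : 0 < √(n : ℝ) := Real.sqrt_pos.2 (by exact_mod_cast hn)
    obtain ⟨hσ0, hσK⟩ := hσ n hn
    have hterm : ∀ i, ∫ ω, |(√(n : ℝ))⁻¹ * ε n i ω / sigmaEps P (ε n)| ^ p ∂P
        ≤ √(n : ℝ) ^ (-p) * ((1 + K) ^ p * (1 + K)) := by
      intro i
      simp_rw [hpow]
      rw [integral_const_mul, Real.mul_rpow (by positivity) (by positivity),
        Real.inv_rpow hs0.le, ← Real.rpow_neg hs0.le, mul_assoc]
      gcongr
      exact hεK n i
    have hs := Finset.sum_le_card_nsmul Finset.univ _ _ (fun i _ => hterm i)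
    simp only [Finset.card_univ, Fintype.card_fin, nsmul_eq_mul] at hs
    refine hs.trans (le_of_eq ?_)
    have : (n : ℝ) = √(n : ℝ) ^ (2 : ℝ) := by
      rw [Real.rpow_two, Real.sq_sqrt (Nat.cast_nonneg n)]
    nth_rewrite 1 [this]
    rw [← mul_assoc, ← Real.rpow_add hs0]
    congr 2
    ring
  · refine (hε_lln.const_mul ((1 + K) ^ 2)).of_norm_le ?_
    filter_upwards [eventually_ge_atTop 1] with n hn
    obtain ⟨hσ0, hσK⟩ := hσ n hn
    refine Eventually.of_forall fun ω => ?_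
    have : ∑ i, ((√(n : ℝ))⁻¹ * ε n i ω / sigmaEps P (ε n)) ^ 2 - 1
        = (sigmaEps P (ε n) ^ 2)⁻¹ * ((n : ℝ)⁻¹ * ∑ i, ε n i ω ^ 2
          - (n : ℝ)⁻¹ * ∑ i, ∫ ω', ε n i ω' ^ 2 ∂P) := by
      simp_rw [hsq]
      rw [← sigmaEps_sq (hε_meas n) (hε_mean n), mul_sub,
        inv_mul_cancel₀ (pow_ne_zero 2 hσ0.ne'), Finset.mul_sum, Finset.mul_sum]
    rw [this, norm_mul, norm_mul, ← inv_pow, norm_pow, norm_pow]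
    gcongr
    rw [Real.norm_of_nonneg (by positivity), Real.norm_of_nonneg (by positivity)]
    exact hσK
  · obtain ⟨hσ0, -⟩ := hσ n hn
    simp_rw [hsq, integral_const_mul]
    rw [← Finset.mul_sum, ← Finset.mul_sum, ← sigmaEps_sq (hε_meas n) (hε_mean n)]
    exact inv_mul_cancel₀ (pow_ne_zero 2 hσ0.ne')

variable [IsProbabilityMeasure P]

theorem integral_abs_rpow_le_one_add {X : Ω → ℝ} (hX : Measurable X) {p q : ℝ} (hq : 0 ≤ q)
    (hqp : q ≤ p) (hp : Integrable (fun ω => |X ω| ^ p) P) :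
    ∫ ω, |X ω| ^ q ∂P ≤ 1 + ∫ ω, |X ω| ^ p ∂P := by
  calc ∫ ω, |X ω| ^ q ∂P ≤ ∫ ω, (1 + |X ω| ^ p) ∂P := by
        refine integral_mono (integrable_of_integrable_abs_rpow hX hq hqp hp)
          ((integrable_const _).add hp) fun ω => ?_
        simp only
        rcases le_or_gt |X ω| 1 with h | h
        · have := Real.rpow_le_one (abs_nonneg (X ω)) h hq
          have := Real.rpow_nonneg (abs_nonneg (X ω)) p
          linarith
        · have := Real.rpow_le_rpow_of_exponent_le h.le hqp
          linarith
    _ = _ := by rw [integral_add (integrable_const _) hp]; simp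

theorem add_rpow_le_two_rpow_mul {a b p : ℝ} (ha : 0 ≤ a) (hb : 0 ≤ b) (hp : 0 ≤ p) :
    (a + b) ^ p ≤ 2 ^ p * (a ^ p + b ^ p) := by
  wlog h : a ≤ b generalizing a b
  · rw [add_comm a, add_comm (a ^ p)]
    exact this hb ha (le_of_not_ge h)
  calc (a + b) ^ p ≤ (2 * b) ^ p := Real.rpow_le_rpow (by positivity) (by linarith) hp
    _ = 2 ^ p * b ^ p := Real.mul_rpow (by norm_num) hb
    _ ≤ _ := by
      gcongr
      linarith [Real.rpow_nonneg ha p]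

theorem standardized_rpow_integral_le {X : Ω → ℝ} (hX : Measurable X) {m σ p C : ℝ} (hp : 1 ≤ p)
    (hm : ∫ ω, X ω ∂P = m) (hσ : 0 < σ) (hσC : σ⁻¹ ≤ C)
    (hXp : Integrable (fun ω => |X ω| ^ p) P) (hXC : ∫ ω, |X ω| ^ p ∂P ≤ C) :
    Integrable (fun ω => |(X ω - m) / σ| ^ p) P ∧
      ∫ ω, |(X ω - m) / σ| ^ p ∂P ≤ C ^ p * (2 ^ p * (C + (1 + C) ^ p)) := by
  have hm1 : |m| ≤ 1 + C := by
    rw [← hm]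
    refine (abs_integral_le_integral_abs).trans ?_
    have := integral_abs_rpow_le_one_add hX zero_le_one hp hXp
    simp only [Real.rpow_one] at this
    linarith
  have hbound : ∀ ω, |(X ω - m) / σ| ^ p ≤ C ^ p * (2 ^ p * (|X ω| ^ p + (1 + C) ^ p)) := by
    intro ω
    have h1 : |(X ω - m) / σ| ≤ C * (|X ω| + (1 + C)) := by
      rw [abs_div, abs_of_pos hσ, div_eq_inv_mul]
      have : |X ω - m| ≤ |X ω| + (1 + C) := (abs_sub _ _).trans (by linarith)
      gcongr
      exact (inv_pos.2 hσ).le.trans hσC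
    have hC : 0 ≤ C := (inv_pos.2 hσ).le.trans hσC
    calc _ ≤ (C * (|X ω| + (1 + C))) ^ p := Real.rpow_le_rpow (abs_nonneg _) h1 (by linarith)
      _ = C ^ p * (|X ω| + (1 + C)) ^ p := Real.mul_rpow hC (by positivity)
      _ ≤ _ := by
        gcongr
        exact add_rpow_le_two_rpow_mul (abs_nonneg _) (by positivity) (by linarith)
  have hint : Integrable (fun ω => C ^ p * (2 ^ p * (|X ω| ^ p + (1 + C) ^ p))) P :=
    ((hXp.add (integrable_const _)).const_mul _).const_mul _
  have hI : Integrable (fun ω => |(X ω - m) / σ| ^ p) P :=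
    hint.mono' (hX.sub_const m |>.div_const σ |>.abs |>.pow_const p).aestronglyMeasurable (Eventually.of_forall fun ω => by
      rw [Real.norm_of_nonneg (by positivity)]
      exact hbound ω)
  refine ⟨hI, (integral_mono hI hint hbound).trans ?_⟩
  have hC : 0 ≤ C := (inv_pos.2 hσ).le.trans hσC
  rw [integral_const_mul, integral_const_mul, integral_add hXp (integrable_const _)]
  simp only [integral_const, probReal_univ, one_smul]
  gcongr

/-- `T` also occurs in the bound on the right. Inserting `|T| ≤ |U| + |T - U|` gives `|T - U|` a
coefficient of at most `1 / 2`, and it moves to the left. -/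
theorem abs_sub_le_of_abs_mul_sub_le {s κ R T U : ℝ} (hκ : 0 ≤ κ) (h : |s * T - U| ≤ R + κ * |T|)
    (hη : κ + |s - 1| ≤ 1 / 2) : |T - U| ≤ 2 * (R + (κ + |s - 1|) * |U|) := by
  have h1 : |T - U| ≤ |s * T - U| + |s - 1| * |T| := by
    rw [← abs_mul]
    calc |T - U| = |(s * T - U) - (s - 1) * T| := by ring_nf
      _ ≤ _ := abs_sub _ _
  have h2 : |T| ≤ |U| + |T - U| := by
    calc |T| = |U + (T - U)| := by ring_nf
      _ ≤ _ := abs_add_le _ _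
  nlinarith [abs_nonneg (s - 1), abs_nonneg (T - U)]

end Standardization

/-! ### Asymptotic linearity and normality of the estimator. -/

/-- Everything (the data, their joint law, the coefficients and the moments `μd`, `σd`) may depend
on the sample size `n`; only the number `p + 1` of controls and the constants `K`, `δ₁`, `δ₂` are
fixed. -/
theorem theorem1 {Ω : Type*} [MeasurableSpace Ω] (P : Measure Ω) [IsProbabilityMeasure P]
    (p : ℕ)
    (d ε y : (n : ℕ) → Fin n → Ω → ℝ)
    (w : (n : ℕ) → Fin n → Ω → EuclideanSpace ℝ (Fin (p + 1)))
    (β : ℕ → ℝ) (γ : ℕ → EuclideanSpace ℝ (Fin (p + 1)))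
    (μd σd : ℕ → ℝ) (K δ₁ δ₂ : ℝ)
    (hd_meas : ∀ n i, Measurable (d n i))
    (hε_meas : ∀ n i, Measurable (ε n i))
    (hw_meas : ∀ n i, Measurable (w n i))
    -- the regression model, with mean-zero errors
    (hmodel : ∀ n i ω, y n i ω = d n i ω * β n + (∑ j, w n i ω j * γ n j) + ε n i ω)
    (hε_mean : ∀ n i, ∫ ω, ε n i ω ∂P = 0)
    (hK : 0 < K) (hδ₁ : 0 < δ₁) (hδ₂ : 0 < δ₂)
    -- the regressor of interest: i.i.d. with mean `μd` and variance `σd ^ 2`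
    (hd_indep : ∀ n, iIndepFun (d n) P)
    (hd_ident : ∀ n i j, IdentDistrib (d n i) (d n j) P P)
    (hd_mean : ∀ n i, ∫ ω, d n i ω ∂P = μd n)
    (hσd_nonneg : ∀ n, 0 ≤ σd n)
    (hd_var : ∀ n i, Var[d n i; P] = σd n ^ 2)
    -- it is independent of the controls, and independent of the errors
    (hdw_indep : ∀ n, IndepFun (fun ω i => d n i ω) (fun ω i => w n i ω) P)
    (hdε_indep : ∀ n, IndepFun (fun ω i => d n i ω) (fun ω i => ε n i ω) P)
    (hd_moment : ∀ n i, Integrable (fun ω => |d n i ω| ^ (2 + δ₁)) P ∧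
      ∫ ω, |d n i ω| ^ (2 + δ₁) ∂P ≤ K)
    (hσd_lower : ∀ n, K⁻¹ ≤ σd n ^ 2)
    -- the controls: smallest eigenvalue at least `K⁻¹ + o_p(1)`, second moments, intercept
    (hw_eig : ∃ r : ℕ → Ω → ℝ, IsLittleOp P r ∧
      ∀ n, ∀ᵐ ω ∂P, K⁻¹ + r n ω ≤ lambdaMin (controlGram fun i => w n i ω))
    (hw_moment : ∀ n i, Integrable (fun ω => ‖w n i ω‖ ^ 2) P ∧ ∫ ω, ‖w n i ω‖ ^ 2 ∂P ≤ K)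
    (hw_const : ∀ n, ∃ c : ℝ, c ≠ 0 ∧ ∀ i, ∀ᵐ ω ∂P, w n i ω 0 = c)
    -- the errors
    (hwε : IsLittleOp P fun (n : ℕ) ω => (n : ℝ)⁻¹ • ∑ i, ε n i ω • w n i ω)
    (hε_lln : IsLittleOp P fun (n : ℕ) ω =>
      (n : ℝ)⁻¹ * ∑ i, ε n i ω ^ 2 - (n : ℝ)⁻¹ * ∑ i, ∫ ω', ε n i ω' ^ 2 ∂P)
    (hε_moment : ∀ n i, Integrable (fun ω => |ε n i ω| ^ (2 + δ₂)) P ∧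
      ∫ ω, |ε n i ω| ^ (2 + δ₂) ∂P ≤ K)
    (hε_lower : ∀ n : ℕ, 1 ≤ n → K⁻¹ ≤ (n : ℝ)⁻¹ * ∑ i, ∫ ω, ε n i ω ^ 2 ∂P) :
    -- asymptotic linear representation
    IsLittleOp P (fun (n : ℕ) ω =>
      √(n : ℝ) * (betaHat (fun i => d n i ω) (fun i => w n i ω) (fun i => y n i ω) - β n) /
          (sigmaEps P (ε n) / σd n)
        - (√(n : ℝ))⁻¹ * (∑ i, (d n i ω - μd n) * ε n i ω) / (σd n * sigmaEps P (ε n))) ∧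
    -- asymptotic normality
    TendstoInDistribution (fun (n : ℕ) ω =>
      √(n : ℝ) * (betaHat (fun i => d n i ω) (fun i => w n i ω) (fun i => y n i ω) - β n) /
          (sigmaEps P (ε n) / σd n))
      atTop (id : ℝ → ℝ) (fun _ => P) (gaussianReal 0 1) := by
  -- One exponent serves regressor and errors alike; the cap at `3` is imposed by the Taylor bound.
  set q : ℝ := 2 + min (min δ₁ δ₂) 1 with hq
  have hδ0 : 0 < min (min δ₁ δ₂) 1 := lt_min (lt_min hδ₁ hδ₂) one_pos
  have hq2 : 2 < q := by linarith
  have hq3 : q ≤ 3 := by linarith [min_le_right (min δ₁ δ₂) 1]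
  have hqδ₁ : q ≤ 2 + δ₁ := by
    linarith [min_le_left (min δ₁ δ₂) 1, min_le_left δ₁ δ₂]
  have hqδ₂ : q ≤ 2 + δ₂ := by
    linarith [min_le_left (min δ₁ δ₂) 1, min_le_right δ₁ δ₂]
  have hσ : ∀ n, 0 < σd n ∧ (σd n)⁻¹ ≤ 1 + K := fun n =>
    inv_le_one_add_of_inv_le_sq hK (hσd_nonneg n) (hσd_lower n)
  have hσε : ∀ n : ℕ, 1 ≤ n → 0 < sigmaEps P (ε n) ∧ (sigmaEps P (ε n))⁻¹ ≤ 1 + K := fun n hn =>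
    inv_le_one_add_of_inv_le_sq hK (Real.sqrt_nonneg _)
      (by rw [sigmaEps_sq (hε_meas n) (hε_mean n)]; exact hε_lower n hn)
  -- the standardized regressor
  set Z : (n : ℕ) → Fin n → Ω → ℝ := fun n i ω => (d n i ω - μd n) / σd n with hZdef
  have hZ_meas : ∀ n i, Measurable (Z n i) := fun n i => by fun_prop
  have hdq : ∀ n i, Integrable (fun ω => |d n i ω| ^ q) P := fun n i =>
    integrable_of_integrable_abs_rpow (hd_meas n i) (by linarith) hqδ₁ (hd_moment n i).1
  have hdK : ∀ n i, ∫ ω, |d n i ω| ^ q ∂P ≤ 1 + K := fun n i =>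
    (integral_abs_rpow_le_one_add (hd_meas n i) (by linarith) hqδ₁ (hd_moment n i).1).trans
      (by linarith [(hd_moment n i).2])
  have hZq := fun n i => standardized_rpow_integral_le (hd_meas n i) (by linarith : 1 ≤ q)
    (hd_mean n i) (hσ n).1 (hσ n).2 (hdq n i) (hdK n i)
  have hZ2 : ∀ n i, MemLp (Z n i) 2 P := fun n i =>
    memLp_two_of_integrable_abs_rpow (hZ_meas n i) hq2.le (hZq n i).1
  have hd_int : ∀ n i, Integrable (d n i) P := fun n i =>
    (memLp_two_of_integrable_abs_rpow (hd_meas n i) hq2.le (hdq n i)).integrable (by norm_num)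
  have hZ0 : ∀ n i, ∫ ω, Z n i ω ∂P = 0 := fun n i => by
    simp only [hZdef]
    rw [integral_div, integral_sub (hd_int n i) (integrable_const _), hd_mean]
    simp
  have hZ1 : ∀ n i, ∫ ω, Z n i ω ^ 2 ∂P = 1 := fun n i => by
    simp only [hZdef, div_pow]
    rw [integral_div, ← hd_mean n i, ← variance_eq_integral (hd_meas n i).aemeasurable, hd_var]
    exact div_self (pow_ne_zero 2 (hσ n).1.ne')
  have hZind : ∀ n, iIndepFun (Z n) P := fun n =>
    (hd_indep n).comp (fun _ x => (x - μd n) / σd n) (fun _ => by fun_prop)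
  have hZw : ∀ n, IndepFun (fun ω i => Z n i ω) (fun ω i => w n i ω) P := fun n =>
    (hdw_indep n).comp (φ := fun (x : Fin n → ℝ) i => (x i - μd n) / σd n)
      (ψ := fun v : Fin n → EuclideanSpace ℝ (Fin (p + 1)) => v) (by fun_prop) measurable_id
  -- the normalized errors
  set V : (n : ℕ) → Fin n → Ω → ℝ := fun n i ω => (√(n : ℝ))⁻¹ * ε n i ω / sigmaEps P (ε n)
    with hVdef
  have hV_meas : ∀ n i, Measurable (V n i) := fun n i => by fun_prop
  have hεq : ∀ n i, Integrable (fun ω => |ε n i ω| ^ q) P := fun n i =>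
    integrable_of_integrable_abs_rpow (hε_meas n i) (by linarith) hqδ₂ (hε_moment n i).1
  obtain ⟨hVq, hVlim, hVlln, hV1⟩ := normalized_errors hε_meas hε_mean hK hq2 hε_lln hεq
    (fun n i => (integral_abs_rpow_le_one_add (hε_meas n i) (by linarith) hqδ₂
      (hε_moment n i).1).trans (by linarith [(hε_moment n i).2])) hε_lower
  have hZV : ∀ n, IndepFun (fun ω i => Z n i ω) (fun ω i => V n i ω) P := fun n =>
    (hdε_indep n).comp (φ := fun (x : Fin n → ℝ) i => (x i - μd n) / σd n)
      (ψ := fun (e : Fin n → ℝ) i => (√(n : ℝ))⁻¹ * e i / sigmaEps P (ε n))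
      (by fun_prop) (by fun_prop)
  set U : ℕ → Ω → ℝ := fun n ω => ∑ i, Z n i ω * V n i ω with hUdef
  have hUdist : TendstoInDistribution U atTop (id : ℝ → ℝ) (fun _ => P) (gaussianReal 0 1) :=
    tendstoInDistribution_sum_mul_of_indepFun hZ_meas hV_meas hZind hZV hZ0 hZ1 hq2.le hq3
      (fun n i => (hZq n i).1) (fun n i => (hZq n i).2) hVq hVlim hVlln
  have hU2 := fun n => integral_sq_sum_mul_of_indepFun (hZ_meas n) (hV_meas n) (hZind n) (hZV n)
    (hZ2 n) (hZ0 n) (hZ1 n)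
    (fun i => memLp_two_of_integrable_abs_rpow (hV_meas n i) hq2.le (hVq n i))
  have hU : ∀ (n : ℕ) ω, (√(n : ℝ))⁻¹ * (∑ i, (d n i ω - μd n) * ε n i ω) / (σd n * sigmaEps P (ε n))
      = U n ω := by
    intro n ω
    simp only [hUdef, hZdef, hVdef]
    rw [Finset.mul_sum, Finset.sum_div]
    exact Finset.sum_congr rfl fun i _ => by ring
  set T : ℕ → Ω → ℝ := fun n ω =>
    √(n : ℝ) * (betaHat (fun i => d n i ω) (fun i => w n i ω) (fun i => y n i ω) - β n) /
      (sigmaEps P (ε n) / σd n) with hTdef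
  have hy_meas : ∀ n i, Measurable (y n i) := fun n i => by
    rw [show y n i = fun ω => d n i ω * β n + (∑ j, w n i ω j * γ n j) + ε n i ω from
      funext (hmodel n i)]
    fun_prop
  have hT_meas : ∀ n, Measurable (T n) := fun n =>
    (((measurable_betaHat (hd_meas n) (hw_meas n) (hy_meas n)).sub_const _).const_mul _).div_const _
  -- the remainder terms
  set a : (n : ℕ) → Ω → EuclideanSpace ℝ (Fin (p + 1)) := fun n ω =>
    (√(n : ℝ))⁻¹ • ∑ i, Z n i ω • w n i ω with hadef
  set g : (n : ℕ) → Ω → EuclideanSpace ℝ (Fin (p + 1)) := fun n ω =>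
    (n : ℝ)⁻¹ • ∑ i, ε n i ω • w n i ω with hgdef
  have ha2 : ∀ n, Integrable (fun ω => ‖a n ω‖ ^ 2) P ∧ ∫ ω, ‖a n ω‖ ^ 2 ∂P ≤ K := by
    intro n
    obtain ⟨hi, he⟩ := integral_norm_sq_sum_smul_of_indepFun (hZ_meas n) (hw_meas n) (hZind n)
      (hZw n) (hZ2 n) (hZ0 n) (hZ1 n) (fun i => (hw_moment n i).1)
    have hna : ∀ ω, ‖a n ω‖ ^ 2 = (n : ℝ)⁻¹ * ‖∑ i, Z n i ω • w n i ω‖ ^ 2 := fun ω => by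
      simp only [hadef]
      rw [norm_smul, mul_pow, norm_inv, inv_pow, Real.norm_of_nonneg (Real.sqrt_nonneg _),
        Real.sq_sqrt (Nat.cast_nonneg n)]
    simp_rw [hna]
    refine ⟨hi.const_mul _, ?_⟩
    rw [integral_const_mul, he]
    have hs := Finset.sum_le_card_nsmul Finset.univ _ _ (fun i _ => (hw_moment n i).2)
    simp only [Finset.card_univ, Fintype.card_fin, nsmul_eq_mul] at hs
    calc _ ≤ (n : ℝ)⁻¹ * (n * K) := by gcongr
      _ = ((n : ℝ)⁻¹ * n) * K := by ring
      _ ≤ 1 * K := by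
        gcongr
        exact inv_mul_le_one
      _ = K := one_mul K
  obtain ⟨r, hr, hr_le⟩ := hw_eig
  -- Half of `K⁻¹` is kept as the eigenvalue bound; the other half absorbs `r` when `|r| < c`.
  set c : ℝ := K⁻¹ / 2 with hcdef
  have hc : 0 < c := by positivity
  -- The coefficient with which `|T|` reappears in its own error bound; its mean is at most `K / (c
  -- n)`.
  set κ : ℕ → Ω → ℝ := fun n ω => ‖a n ω‖ ^ 2 / (c * n) with hκdef
  have hκ0 : ∀ n ω, 0 ≤ κ n ω := fun n ω => by positivity
  have hκo : IsLittleOp P κ := by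
    refine isLittleOp_of_tendsto_integral_norm (fun n => (ha2 n).1.div_const _) ?_
    have hlim : Tendsto (fun n : ℕ => K / c * (n : ℝ)⁻¹) atTop (𝓝 0) := by
      simpa using tendsto_inv_atTop_nhds_zero_nat.const_mul (K / c)
    refine squeeze_zero (fun n => integral_nonneg fun ω => norm_nonneg _) (fun n => ?_) hlim
    simp_rw [Real.norm_of_nonneg (hκ0 n _)]
    simp only [hκdef]
    rw [integral_div]
    calc _ ≤ K / (c * n) := by
          gcongr
          exact (ha2 n).2
      _ = _ := by rw [div_mul_eq_div_div, div_eq_mul_inv (K / c)]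
  set ρ : ℕ → Ω → ℝ := fun n ω => (n : ℝ)⁻¹ * ∑ i, Z n i ω ^ 2 - 1 with hρdef
  have hρo : IsLittleOp P ρ := isLittleOp_mean_sq_sub_one hZ_meas hZind hZ1 hq2
    (fun n i => (hZq n i).1) (fun n i => (hZq n i).2)
  have hηo : IsLittleOp P fun n ω => κ n ω + |ρ n ω| := hκo.add hρo.norm
  -- Outside these events the Gram matrix is bounded below by `c` and `κ + |ρ| < 1 / 2`, which
  -- yields both nonsingularity, through `κ < 1 + ρ`, and the absorption of `|T|`.
  have hbad : Tendsto (fun n => P ({ω | c ≤ ‖r n ω‖} ∪ {ω | 1 / 2 ≤ ‖κ n ω + |ρ n ω|‖})) atTop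
      (𝓝 0) := by
    have := (isLittleOp_iff.1 hr c hc).add (isLittleOp_iff.1 hηo (1 / 2) (by norm_num))
    rw [add_zero] at this
    exact tendsto_of_tendsto_of_tendsto_of_le_of_le tendsto_const_nhds this (fun _ => zero_le)
      fun n => measure_union_le _ _
  have hga : IsLittleOp P fun n ω => ‖g n ω‖ * ‖a n ω‖ :=
    hwε.norm.mul_of_integral_sq_le (Eventually.of_forall fun n => (ha2 n).1)
      (Eventually.of_forall fun n => (ha2 n).2)
  have hηU : IsLittleOp P fun n ω => (κ n ω + |ρ n ω|) * U n ω :=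
    hηo.mul_of_integral_sq_le (Eventually.of_forall fun n => (hU2 n).1)
      ((eventually_ge_atTop 1).mono fun n hn => ((hU2 n).2.trans (hV1 n hn)).le)
  have hR : IsLittleOp P fun n ω =>
      2 * ((1 + K) / c * (‖g n ω‖ * ‖a n ω‖) + ‖(κ n ω + |ρ n ω|) * U n ω‖) :=
    ((hga.const_mul _).add hηU.norm).const_mul 2
  have hlin : IsLittleOp P fun n ω => T n ω - U n ω := by
    refine hR.of_norm_le_off hbad ?_
    filter_upwards [eventually_ge_atTop 1] with n hn
    obtain ⟨c₀, hc₀, hwc⟩ := hw_const n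
    obtain ⟨hσε0, hσεK⟩ := hσε n hn
    have hσ0 := (hσ n).1
    have hn0 : (0 : ℝ) < n := by exact_mod_cast hn
    filter_upwards [ae_all_iff.2 hwc, hr_le n] with ω hω0 hωr hgood
    simp only [Set.mem_union, Set.mem_ofPred_eq, not_or, not_le] at hgood
    obtain ⟨hg1, hg2⟩ := hgood
    have hmin : c ≤ lambdaMin (controlGram fun i => w n i ω) := by
      refine le_trans ?_ hωr
      have := (abs_lt.1 (show |r n ω| < c from hg1)).1
      have : K⁻¹ = 2 * c := by rw [hcdef]; ring
      linarith
    have hη : κ n ω + |ρ n ω| < 1 / 2 := (le_abs_self _).trans_lt hg2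
    have hdet := abs_betaHat_sub_le hn (z := fun i => Z n i ω) (ε := fun i => ε n i ω) hσ0.ne' hc₀
      hc (m := μd n) (fun i => by simp only [hZdef]; field_simp; ring) hω0
      (fun i => hmodel n i ω) hmin (by
        have h1 := neg_abs_le (ρ n ω)
        have h2 : (n : ℝ)⁻¹ * ∑ i, Z n i ω ^ 2 = ρ n ω + 1 := by simp only [hρdef]; ring
        have h3 : κ n ω < ρ n ω + 1 := by linarith
        rw [h2]
        exact h3)
    have hTe : √(n : ℝ) * (σd n * (betaHat (fun i => d n i ω) (fun i => w n i ω)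
        (fun i => y n i ω) - β n)) = sigmaEps P (ε n) * T n ω := by
      simp only [hTdef]
      field_simp
    have hUe : (√(n : ℝ))⁻¹ * ∑ i, Z n i ω * ε n i ω = sigmaEps P (ε n) * U n ω := by
      simp only [hUdef, hVdef, Finset.mul_sum]
      refine Finset.sum_congr rfl fun i _ => ?_
      field_simp
    have hs1 : (n : ℝ)⁻¹ * ∑ i, Z n i ω ^ 2 - 1 = ρ n ω := rfl
    rw [hTe, hUe] at hdet
    change _ ≤ ‖a n ω‖ * ((‖g n ω‖ + ‖a n ω‖ * |sigmaEps P (ε n) * T n ω| / n) / c) at hdet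
    set s : ℝ := (n : ℝ)⁻¹ * ∑ i, Z n i ω ^ 2 with hsdef
    have hmain : |s * T n ω - U n ω| ≤ (1 + K) / c * (‖g n ω‖ * ‖a n ω‖) + κ n ω * |T n ω| := by
      have h1 : sigmaEps P (ε n) * |s * T n ω - U n ω|
          = |s * (sigmaEps P (ε n) * T n ω) - sigmaEps P (ε n) * U n ω| := by
        rw [← abs_of_pos hσε0, ← abs_mul, abs_of_pos hσε0]
        congr 1
        ring
      rw [← h1, abs_mul, abs_of_pos hσε0] at hdet
      have h2 : |s * T n ω - U n ω| ≤ (sigmaEps P (ε n))⁻¹ * (‖a n ω‖ *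
          ((‖g n ω‖ + ‖a n ω‖ * (sigmaEps P (ε n) * |T n ω|) / n) / c)) := by
        rw [le_inv_mul_iff₀ hσε0]
        exact hdet
      calc _ ≤ _ := h2
        _ = (sigmaEps P (ε n))⁻¹ / c * (‖g n ω‖ * ‖a n ω‖) + κ n ω * |T n ω| := by
          simp only [hκdef]
          field_simp
        _ ≤ _ := by gcongr
    have hfin := abs_sub_le_of_abs_mul_sub_le (hκ0 n ω) hmain (by rw [hs1]; exact hη.le)
    rw [hs1] at hfin
    refine le_trans hfin (le_trans (le_of_eq ?_) (le_abs_self _))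
    rw [norm_mul, Real.norm_of_nonneg (add_nonneg (hκ0 n ω) (abs_nonneg _)), Real.norm_eq_abs]
  refine ⟨?_, ?_⟩
  · simp_rw [hU]
    exact hlin
  -- Slutsky's lemma transfers the limit of `U` to `T`.
  · exact tendstoInDistribution_of_tendstoInMeasure_sub T id hUdist hlin
      fun n => (hT_meas n).aemeasurable
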